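/- Let $\mathfrak{g}=\mathfrak{sl}(3,\mathbb{C})$, let $K=S(U(2)\times U(1))$ be the group of unitary $3\times 3$ matrices of determinant $1$ that are block diagonal with respect to $\mathbb{C}^3=\mathbb{C}^2\oplus\mathbb{C}$ (the standard maximal compact subgroup of $SU(2,1)$), and let $\mathfrak{k}\subset\mathfrak{g}$ be its complexified Lie algebra, i.e. the subalgebra of block diagonal matrices of trace zero. $K$ acts on the universal enveloping algebra $U(\mathfrak{g})$ by algebra automorphisms extending the adjoint action $X\mapsto gXg^{-1}$ on $\mathfrak{g}$; let $U(\mathfrak{g})^K$ be the algebra of invariants. Let $Z(\mathfrak{g})$ be the center of $U(\mathfrak{g})$ and $Z(\mathfrak{k})$ the center of $U(\mathfrak{k})$, viewed in $U(\mathfrak{g})$. Let $e_{ij}$ be the matrix units and put $$H_1=\tfrac13(2e_{11}-e_{22}-e_{33}),\quad H_2=\tfrac13(-e_{11}+2e_{22}-e_{33}),\quad H=H_1-H_2,$$ $$E=e_{12},\quad F=e_{21},\quad E_1=e_{13},\quad E_2=e_{23},\quad F_1=e_{31},\quad F_2=e_{32},$$ and, in $U(\mathfrak{g})$, $$\tilde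 a=H_1+H_2,\qquad \tilde b=H^2+2(EF+FE),\qquad \tilde c=E_1F_1+E_2F_2,$$ $$\tilde d=2EE_2F_1+HE_1F_1-HE_2F_2+2FE_1F_2,$$ $$\Omega=\tfrac12(H_1-H_2)^2+\tfrac32(H_1+H_2)^2+EF+FE+E_1F_1+E_2F_2+F_1E_1+F_2E_2,$$ $$\mathrm{cub}=-\tfrac32\tilde a^3+\tfrac32\tilde a\tilde b-3\tilde a\tilde c+\tfrac92\tilde a^2-3\tilde a+3\tilde d-\tfrac32\tilde b .$$ Then: 1. $U(\mathfrak{g})^K=Z(\mathfrak{g})Z(\mathfrak{k})$, where the right-hand side is the linear span of the products $zw$ with $z\in Z(\mathfrak{g})$, $w\in Z(\mathfrak{k})$. 2. The algebra $U(\mathfrak{g})^K$ is generated by $\tilde a,\tilde b,\tilde c,\tilde d$, and $\tilde a,\tilde b\in Z(\mathfrak{k})$. 3. $\Omega$ is the Casimir element of $U(\mathfrak{g})$ for the trace form $\operatorname{tr}(XY)$, that is, $\Omega=\sum_i e_ie_i'$ for every basis $(e_i)$ of $\mathfrak{g}$ and its dual basis $(e_i')$ with respect to the trace form; moreover $\Omega,\mathrm{cub}\in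 Z(\mathfrak{g})$. 4. One has $\Omega=\tfrac32\tilde a^2+\tfrac12\tilde b+2\tilde c-3\tilde a$, and hence $$\tilde c=\tfrac12\Omega-\tfrac34\tilde a^2-\tfrac14\tilde b+\tfrac32\tilde a,$$ $$\tilde d=\tfrac13\,\mathrm{cub}+\tfrac12\tilde a\,\Omega-\tfrac14\tilde a^3-\tfrac34\tilde a\tilde b+\tilde a+\tfrac12\tilde b .$$ -/

import Mathlib

noncomputable section

namespace SU21

attribute [local instance 100] LieRing.ofAssociativeRing

open scoped Matrix

/-- The complex Lie algebra `𝔤 = 𝔰𝔩(3, ℂ)`, the complexification of `𝔰𝔲(2,1)`. -/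
abbrev sl3 : LieSubalgebra ℂ (Matrix (Fin 3) (Fin 3) ℂ) :=
  LieAlgebra.SpecialLinear.sl (Fin 3) ℂ

theorem mem_sl3 {X : Matrix (Fin 3) (Fin 3) ℂ} : X ∈ sl3 ↔ X.trace = 0 := Iff.rfl

/-- The universal enveloping algebra `U(𝔤)`. -/
abbrev Ug : Type := UniversalEnvelopingAlgebra ℂ sl3

/-- The canonical map `𝔤 → U(𝔤)`. -/
abbrev incl : sl3 →ₗ⁅ℂ⁆ Ug := UniversalEnvelopingAlgebra.ι ℂ

/-! ### The basis of `𝔤` -/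

/-- `H₁ = (2 e₁₁ - e₂₂ - e₃₃) / 3`. -/
def H1 : sl3 := ⟨Matrix.diagonal ![2 / 3, -1 / 3, -1 / 3], by
  rw [mem_sl3]; simp [Matrix.trace_diagonal, Fin.sum_univ_three]; norm_num⟩

/-- `H₂ = (-e₁₁ + 2 e₂₂ - e₃₃) / 3`. -/
def H2 : sl3 := ⟨Matrix.diagonal ![-1 / 3, 2 / 3, -1 / 3], by
  rw [mem_sl3]; simp [Matrix.trace_diagonal, Fin.sum_univ_three]; norm_num⟩

/-- The matrix unit `e_{ij}`, `i ≠ j`, as an element of `𝔤` (rows and columns start at `0`). -/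
def unit (i j : Fin 3) (h : i ≠ j) : sl3 := LieAlgebra.SpecialLinear.single i j h (1 : ℂ)

/-- `E = e₁₂`. -/
def E : sl3 := unit 0 1 (by decide)
/-- `F = e₂₁`. -/
def F : sl3 := unit 1 0 (by decide)
/-- `E₁ = e₁₃`. -/
def E1 : sl3 := unit 0 2 (by decide)
/-- `E₂ = e₂₃`. -/
def E2 : sl3 := unit 1 2 (by decide)
/-- `F₁ = e₃₁`. -/
def F1 : sl3 := unit 2 0 (by decide)
/-- `F₂ = e₃₂`. -/
def F2 : sl3 := unit 2 1 (by decide)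

/-- `H = H₁ - H₂`. -/
def H : sl3 := H1 - H2

/-! ### The group `K` and its action -/

/-- A `3 × 3` matrix is block diagonal if it respects `ℂ³ = ℂ² ⊕ ℂ`. -/
def IsBlockDiag (X : Matrix (Fin 3) (Fin 3) ℂ) : Prop :=
  X 0 2 = 0 ∧ X 1 2 = 0 ∧ X 2 0 = 0 ∧ X 2 1 = 0

theorem IsBlockDiag.mul {X Y : Matrix (Fin 3) (Fin 3) ℂ} (hX : IsBlockDiag X)
    (hY : IsBlockDiag Y) : IsBlockDiag (X * Y) := by
  obtain ⟨h1, h2, h3, h4⟩ := hX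
  obtain ⟨k1, k2, k3, k4⟩ := hY
  simp [IsBlockDiag, Matrix.mul_apply, Fin.sum_univ_three, *]

theorem IsBlockDiag.sub {X Y : Matrix (Fin 3) (Fin 3) ℂ} (hX : IsBlockDiag X)
    (hY : IsBlockDiag Y) : IsBlockDiag (X - Y) := by
  obtain ⟨h1, h2, h3, h4⟩ := hX
  obtain ⟨k1, k2, k3, k4⟩ := hY
  simp [IsBlockDiag, *]

/-- The maximal compact subgroup `K = S(U(2) × U(1))` of `SU(2,1)`: the unitary block diagonal
matrices of determinant one. -/
def K : Set (Matrix.SpecialLinearGroup (Fin 3) ℂ) :=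
  {g | (g.1)ᴴ * g.1 = 1 ∧ IsBlockDiag g.1}

/-- The form `γ = diag(1, 1, -1)`. -/
def gam : Matrix (Fin 3) (Fin 3) ℂ := Matrix.diagonal ![1, 1, -1]

/-- `K` consists of the `g ∈ SU(2,1) = {g ∈ SL(3, ℂ) | g* γ g = γ}` that are fixed by the Cartan
involution `g ↦ (g*)⁻¹`, that is, unitary. -/
theorem mem_K_iff (g : Matrix.SpecialLinearGroup (Fin 3) ℂ) :
    g ∈ K ↔ (g.1)ᴴ * gam * g.1 = gam ∧ (g.1)ᴴ * g.1 = 1 := by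
  have key : IsBlockDiag g.1 ↔ gam * g.1 = g.1 * gam := by
    constructor
    · rintro ⟨h1, h2, h3, h4⟩
      ext i j
      fin_cases i <;> fin_cases j <;> simp [gam, h1, h2, h3, h4]
    · intro h
      have e : ∀ i j, (gam * g.1) i j = (g.1 * gam) i j := fun i j => by rw [h]
      have e02 := e 0 2
      have e12 := e 1 2
      have e20 := e 2 0
      have e21 := e 2 1
      simp [gam] at e02 e12 e20 e21
      exact ⟨self_eq_neg.mp e02, self_eq_neg.mp e12, neg_eq_self.mp e20, neg_eq_self.mp e21⟩
  constructor
  · rintro ⟨h, hb⟩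
    refine ⟨?_, h⟩
    rw [mul_assoc, key.mp hb, ← mul_assoc, h, one_mul]
  · rintro ⟨h1, h2⟩
    refine ⟨h2, key.mpr ?_⟩
    have h3 : g.1 * (g.1)ᴴ = 1 := mul_eq_one_comm.mp h2
    calc gam * g.1 = g.1 * (g.1)ᴴ * (gam * g.1) := by rw [h3, one_mul]
      _ = g.1 * ((g.1)ᴴ * gam * g.1) := by simp only [mul_assoc]
      _ = g.1 * gam := by rw [h1]

/-- The adjoint action `Ad g : X ↦ g X g⁻¹` on `𝔤`. -/
def Ad (g : Matrix.SpecialLinearGroup (Fin 3) ℂ) : sl3 →ₗ⁅ℂ⁆ sl3 where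
  toFun X := ⟨g.1 * X.1 * (g⁻¹).1, by
    have hg : (g⁻¹).1 * g.1 = 1 := congrArg Subtype.val (inv_mul_cancel g)
    rw [mem_sl3, Matrix.trace_mul_comm, ← mul_assoc, hg, one_mul]
    exact X.2⟩
  map_add' X Y := by ext1; simp [mul_add, add_mul]
  map_smul' c X := by ext1; simp
  map_lie' := by
    intro X Y
    have hg : (g⁻¹).1 * g.1 = 1 := congrArg Subtype.val (inv_mul_cancel g)
    have h : ∀ A B : Matrix (Fin 3) (Fin 3) ℂ,
        g.1 * A * (g⁻¹).1 * (g.1 * B * (g⁻¹).1) = g.1 * (A * B) * (g⁻¹).1 := fun A B => by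
      calc _ = g.1 * A * ((g⁻¹).1 * g.1) * B * (g⁻¹).1 := by simp only [mul_assoc]
        _ = _ := by rw [hg, mul_one]; simp only [mul_assoc]
    ext1
    change g.1 * (X.1 * Y.1 - Y.1 * X.1) * (g⁻¹).1 =
      g.1 * X.1 * (g⁻¹).1 * (g.1 * Y.1 * (g⁻¹).1) - g.1 * Y.1 * (g⁻¹).1 * (g.1 * X.1 * (g⁻¹).1)
    rw [h, h, mul_sub, sub_mul]

/-- The extension of `Ad g` to an algebra endomorphism of `U(𝔤)`. -/
def AdU (g : Matrix.SpecialLinearGroup (Fin 3) ℂ) : Ug →ₐ[ℂ] Ug :=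
  UniversalEnvelopingAlgebra.lift ℂ (incl.comp (Ad g))

/-- The algebra `U(𝔤)^K` of `K`-invariants in `U(𝔤)`. -/
def UgK : Subalgebra ℂ Ug :=
  ⨅ g ∈ K, AlgHom.equalizer (AdU g) (AlgHom.id ℂ Ug)

theorem mem_UgK {u : Ug} : u ∈ UgK ↔ ∀ g ∈ K, AdU g u = u := by
  simp [UgK, Algebra.mem_iInf]

/-! ### The subalgebra `𝔨` and the two centers -/

/-- The complexified Lie algebra `𝔨 ≅ 𝔤𝔩(2, ℂ)` of `K`: the block diagonal matrices in `𝔤`. -/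
def k : LieSubalgebra ℂ sl3 where
  carrier := {X | IsBlockDiag X.1}
  add_mem' := by
    rintro X Y ⟨h1, h2, h3, h4⟩ ⟨k1, k2, k3, k4⟩
    simp [IsBlockDiag, *]
  zero_mem' := by simp [IsBlockDiag]
  smul_mem' := by
    rintro c X ⟨h1, h2, h3, h4⟩
    simp [IsBlockDiag, *]
  lie_mem' := fun {X Y} hX hY =>
    show IsBlockDiag (X.1 * Y.1 - Y.1 * X.1) from
      (IsBlockDiag.mul hX hY).sub (IsBlockDiag.mul hY hX)

/-- `𝔨` is the span of `H₁, H₂, E, F`. -/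
theorem k_eq_span : k.toSubmodule = Submodule.span ℂ {H1, H2, E, F} := by
  apply le_antisymm
  · intro X hX
    obtain ⟨h1, h2, h3, h4⟩ := (show IsBlockDiag X.1 from hX)
    have ht : X.1 0 0 + X.1 1 1 + X.1 2 2 = 0 := by
      have := X.2
      rw [mem_sl3, Matrix.trace_fin_three] at this
      exact this
    have : X = (X.1 0 0 - X.1 2 2) • H1 + (X.1 1 1 - X.1 2 2) • H2 + X.1 0 1 • E
        + X.1 1 0 • F := by
      ext i j
      fin_cases i <;> fin_cases j <;>
        simp [H1, H2, E, F, unit, h1, h2, h3, h4] <;>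
        linear_combination (1 / 3) * ht
    rw [this]
    refine add_mem (add_mem (add_mem ?_ ?_) ?_) ?_ <;>
      exact Submodule.smul_mem _ _ (Submodule.subset_span (by simp))
  · rw [Submodule.span_le]
    rintro X (rfl | rfl | rfl | rfl) <;> change IsBlockDiag _ <;>
      simp [IsBlockDiag, H1, H2, E, F, unit]

/-- The algebra map `U(𝔨) → U(𝔤)` induced by the inclusion of `𝔨` in `𝔤`. -/
def inclUk : UniversalEnvelopingAlgebra ℂ k →ₐ[ℂ] Ug :=
  UniversalEnvelopingAlgebra.lift ℂ (incl.comp k.incl)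

/-- The center `Z(𝔤)` of `U(𝔤)`. -/
def Zg : Subalgebra ℂ Ug := Subalgebra.center ℂ Ug

/-- The center `Z(𝔨)` of `U(𝔨)`, viewed inside `U(𝔤)`. -/
def Zk : Subalgebra ℂ Ug := (Subalgebra.center ℂ (UniversalEnvelopingAlgebra ℂ k)).map inclUk

/-! ### Explicit elements of `U(𝔤)` -/

/-- `ã = H₁ + H₂`. -/
def aT : Ug := incl H1 + incl H2

/-- `b̃ = H² + 2 (E F + F E)`. -/
def bT : Ug := incl H ^ 2 + 2 * (incl E * incl F + incl F * incl E)

/-- `c̃ = E₁ F₁ + E₂ F₂`. -/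
def cT : Ug := incl E1 * incl F1 + incl E2 * incl F2

/-- `d̃ = 2 E E₂ F₁ + H E₁ F₁ - H E₂ F₂ + 2 F E₁ F₂`. -/
def dT : Ug :=
  2 * incl E * incl E2 * incl F1 + incl H * incl E1 * incl F1 - incl H * incl E2 * incl F2
    + 2 * incl F * incl E1 * incl F2

/-- The Casimir element `Ω` of `U(𝔤)` for the trace form `tr (X Y)`, as the sum `∑ eᵢ eⁱ` over
the basis `H₁ - H₂, H₁ + H₂, E, F, E₁, E₂, F₁, F₂` and its dual basis. -/
def Cas : Ug :=
  (1 / 2 : ℂ) • (incl H1 - incl H2) ^ 2 + (3 / 2 : ℂ) • (incl H1 + incl H2) ^ 2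
    + incl E * incl F + incl F * incl E + incl E1 * incl F1 + incl E2 * incl F2
    + incl F1 * incl E1 + incl F2 * incl E2

/-- The cubic element
`cub = -(3/2) ã³ + (3/2) ã b̃ - 3 ã c̃ + (9/2) ã² - 3 ã + 3 d̃ - (3/2) b̃`. -/
def cub : Ug :=
  -((3 / 2 : ℂ) • aT ^ 3) + (3 / 2 : ℂ) • (aT * bT) - (3 : ℂ) • (aT * cT)
    + (9 / 2 : ℂ) • aT ^ 2 - (3 : ℂ) • aT + (3 : ℂ) • dT - (3 / 2 : ℂ) • bT

end SU21

end

noncomputable section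

namespace SU21

attribute [local instance 100] LieRing.ofAssociativeRing

open scoped Matrix

/-! The point is that `UgK` is the centralizer of 𝔨, and that this centralizer is generated by ã,
b̃, c̃, d̃. The generators are `K`-invariant by direct expansion (`AdU_fixes`). Conversely, a
`K`-invariant commutes with 𝔨 (`commute_k_of_mem_UgK`): for HA and H, a torus element of infinite
order detects weight zero, and conjugating H by two further elements of `K` reaches E and F.

That the centralizer lies in `genAlg` is proved by induction on the order, through symbols in S(𝔤).
The symbol is treated as a linear relation `sym n` inside S(𝔤) × U(𝔤), so that existence and
multiplicativity are formal; single-valuedness is the Poincaré–Birkhoff–Witt theorem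
(`eq_zero_of_mem_sym`), obtained from a representation by twisted differential operators. The symbol
of an element commuting with 𝔨 is a 𝔨-invariant polynomial, and such a polynomial is a polynomial in
the four basic invariants (`exists_eq_aeval_inv`), because the flows of 𝔨 carry a generic point into
an affine section on which these invariants are coordinates. Subtracting an element of `genAlg` with
the same symbol lowers the order (`mem_genAlg_of_commK`).

Products from Z(𝔤) and Z(𝔨) commute with 𝔨, hence are invariant. For the other inclusion, ã and b̃
are central in U(𝔨), Ω and cub are central in U(𝔤), and `cT_eq`, `dT_eq` express c̃ and d̃ through
these four. -/

/-! ### A basis of `𝔤` and its structure constants -/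

/-- `H₁ + H₂ = (e₁₁ + e₂₂ - 2 e₃₃) / 3`. -/
def HA : sl3 := H1 + H2

theorem HA_val : HA.1 = !![1 / 3, 0, 0; 0, 1 / 3, 0; 0, 0, -2 / 3] := by
  ext i j
  fin_cases i <;> fin_cases j <;> simp [HA, H1, H2] <;> norm_num

theorem H_val : H.1 = !![1, 0, 0; 0, -1, 0; 0, 0, 0] := by
  ext i j
  fin_cases i <;> fin_cases j <;> simp [H, H1, H2] <;> norm_num

theorem E_val : E.1 = !![0, 1, 0; 0, 0, 0; 0, 0, 0] := by
  ext i j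
  fin_cases i <;> fin_cases j <;> simp [E, unit]

theorem F_val : F.1 = !![0, 0, 0; 1, 0, 0; 0, 0, 0] := by
  ext i j
  fin_cases i <;> fin_cases j <;> simp [F, unit]

theorem E1_val : E1.1 = !![0, 0, 1; 0, 0, 0; 0, 0, 0] := by
  ext i j
  fin_cases i <;> fin_cases j <;> simp [E1, unit]

theorem E2_val : E2.1 = !![0, 0, 0; 0, 0, 1; 0, 0, 0] := by
  ext i j
  fin_cases i <;> fin_cases j <;> simp [E2, unit]

theorem F1_val : F1.1 = !![0, 0, 0; 0, 0, 0; 1, 0, 0] := by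
  ext i j
  fin_cases i <;> fin_cases j <;> simp [F1, unit]

theorem F2_val : F2.1 = !![0, 0, 0; 0, 0, 0; 0, 1, 0] := by
  ext i j
  fin_cases i <;> fin_cases j <;> simp [F2, unit]

/-- The basis `H₁ + H₂, H, E, F, E₁, E₂, F₁, F₂` of `𝔤`. -/
def bas : Fin 8 → sl3 := ![HA, H, E, F, E1, E2, F1, F2]

/-- The coordinates of a matrix with respect to `bas`. -/
def coord : Fin 8 → Matrix (Fin 3) (Fin 3) ℂ →ₗ[ℂ] ℂ :=
  let e (i j : Fin 3) : Matrix (Fin 3) (Fin 3) ℂ →ₗ[ℂ] ℂ := Matrix.entryLinearMap ℂ ℂ i j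
  ![(-3 / 2 : ℂ) • e 2 2, (1 / 2 : ℂ) • (e 0 0 - e 1 1), e 0 1, e 1 0, e 0 2, e 1 2, e 2 0, e 2 1]

theorem trace_eq (X : sl3) : X.1 0 0 + X.1 1 1 + X.1 2 2 = 0 := by
  have := X.2
  rw [mem_sl3, Matrix.trace_fin_three] at this
  exact this

theorem sum_coord (X : sl3) : ∑ i, coord i X.1 • bas i = X := by
  have ht := trace_eq X
  ext i j
  fin_cases i <;> fin_cases j <;>
    simp [Fin.sum_univ_eight, coord, bas, HA_val, H_val, E_val, F_val, E1_val, E2_val,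
      F1_val, F2_val] <;>
    first | ring1 | linear_combination (-1 / 2) * ht

theorem coord_bas (i j : Fin 8) : coord i (bas j).1 = if i = j then 1 else 0 := by
  fin_cases i <;> fin_cases j <;>
    simp [coord, bas, HA_val, H_val, E_val, F_val, E1_val, E2_val,
      F1_val, F2_val] <;> norm_num

theorem ext_coord {X Y : sl3} (h : ∀ i, coord i X.1 = coord i Y.1) : X = Y := by
  rw [← sum_coord X, ← sum_coord Y]
  simp only [h]

theorem eq_of_mem_k (X : sl3) (h : X ∈ k) :
    X = coord 0 X.1 • bas 0 + coord 1 X.1 • bas 1 + coord 2 X.1 • bas 2 + coord 3 X.1 • bas 3 := by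
  obtain ⟨h1, h2, h3, h4⟩ := (show IsBlockDiag X.1 from h)
  conv_lhs => rw [← sum_coord X]
  simp [Fin.sum_univ_eight, coord, h1, h2, h3, h4]

theorem lie_val (X Y : sl3) : (⁅X, Y⁆ : sl3).1 = X.1 * Y.1 - Y.1 * X.1 := rfl

-- Each bracket has the later element of `bas` on the left, so the relations serve as rewriting
-- rules that sort products into the order of `bas`.
set_option maxHeartbeats 2000000 in
theorem lie_table :
    ⁅H, HA⁆ = 0 ∧ ⁅E, HA⁆ = 0 ∧ ⁅E, H⁆ = (-2 : ℂ) • E ∧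
    ⁅F, HA⁆ = 0 ∧ ⁅F, H⁆ = (2 : ℂ) • F ∧ ⁅F, E⁆ = -H ∧
    ⁅E1, HA⁆ = -E1 ∧ ⁅E1, H⁆ = -E1 ∧ ⁅E1, E⁆ = 0 ∧
    ⁅E1, F⁆ = -E2 ∧ ⁅E2, HA⁆ = -E2 ∧ ⁅E2, H⁆ = E2 ∧
    ⁅E2, E⁆ = -E1 ∧ ⁅E2, F⁆ = 0 ∧ ⁅E2, E1⁆ = 0 ∧
    ⁅F1, HA⁆ = F1 ∧ ⁅F1, H⁆ = F1 ∧ ⁅F1, E⁆ = F2 ∧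
    ⁅F1, F⁆ = 0 ∧ ⁅F1, E1⁆ = (-3/2 : ℂ) • HA + (-1/2 : ℂ) • H ∧ ⁅F1, E2⁆ = -F ∧
    ⁅F2, HA⁆ = F2 ∧ ⁅F2, H⁆ = -F2 ∧ ⁅F2, E⁆ = 0 ∧
    ⁅F2, F⁆ = F1 ∧ ⁅F2, E1⁆ = -E ∧ ⁅F2, E2⁆ = (-3/2 : ℂ) • HA + (1/2 : ℂ) • H ∧
    ⁅F2, F1⁆ = 0 := by
  refine ⟨?_, ?_, ?_, ?_, ?_, ?_, ?_, ?_, ?_, ?_, ?_, ?_, ?_, ?_, ?_, ?_, ?_, ?_, ?_, ?_, ?_, ?_,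
    ?_, ?_, ?_, ?_, ?_, ?_⟩ <;> ext i j <;> rw [lie_val] <;>
    fin_cases i <;> fin_cases j <;>
    simp [HA_val, H_val, E_val, F_val, E1_val, E2_val, F1_val, F2_val, smul_eq_mul] <;> norm_num

/-! ### Computing in `U(𝔤)` -/

theorem incl_mul_comm (X Y : sl3) : incl X * incl Y = incl Y * incl X + incl ⁅X, Y⁆ := by
  rw [LieHom.map_lie, LieRing.of_associative_ring_bracket]
  abel

theorem incl_mul_comm_assoc (X Y : sl3) (u : Ug) :
    incl X * (incl Y * u) = incl Y * (incl X * u) + incl ⁅X, Y⁆ * u := by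
  rw [← mul_assoc, incl_mul_comm, add_mul, mul_assoc]

theorem H1_eq : H1 = (1 / 2 : ℂ) • HA + (1 / 2 : ℂ) • H := by
  rw [HA, H]; module

theorem H2_eq : H2 = (1 / 2 : ℂ) • HA - (1 / 2 : ℂ) • H := by
  rw [HA, H]; module

theorem aT_eq : aT = incl HA := (map_add incl H1 H2).symm

theorem Cas_eq : Cas = (3 / 2 : ℂ) • aT ^ 2 + (1 / 2 : ℂ) • bT + (2 : ℂ) • cT - (3 : ℂ) • aT := by
  obtain ⟨h1, h2, h3, h4, h5, h6, h7, h8, h9, h10, h11, h12, h13, h14, h15, h16, h17, h18, h19, h20,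
    h21, h22, h23, h24, h25, h26, h27, h28⟩ := lie_table
  -- The two commutators add up to -3 HA, the source of the term -3ã.
  have t1 := incl_mul_comm F1 E1
  have t2 := incl_mul_comm F2 E2
  rw [h20] at t1
  rw [h27] at t2
  rw [Cas, aT_eq, bT, cT, H1_eq, H2_eq, t1, t2]
  simp only [map_add, map_sub, map_smul, two_mul, mul_add, add_mul, mul_sub, sub_mul,
    smul_mul_assoc, mul_smul_comm, smul_smul, smul_add, smul_sub, pow_two]
  module

theorem cT_eq : cT = (1 / 2 : ℂ) • Cas - (3 / 4 : ℂ) • aT ^ 2 - (1 / 4 : ℂ) • bT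
    + (3 / 2 : ℂ) • aT := by
  rw [Cas_eq]; module

theorem dT_eq : dT = (1 / 3 : ℂ) • cub + (1 / 2 : ℂ) • (aT * Cas) - (1 / 4 : ℂ) • aT ^ 3
    - (3 / 4 : ℂ) • (aT * bT) + aT + (1 / 2 : ℂ) • bT := by
  rw [Cas_eq, cub]
  simp only [mul_add, mul_sub, mul_smul_comm, smul_smul, smul_add, smul_sub, smul_neg,
    ← pow_succ' aT 2, ← pow_two aT]
  module

-- Sorting all products into the order of `bas` gives both sides the same normal form. Only E₂ and
-- F₂ need checking, since 𝔨, E₂ and F₂ generate 𝔤 and commutation with 𝔨 comes from `K`-invariance.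
set_option linter.unusedSimpArgs false in
set_option maxHeartbeats 1000000 in
theorem commute_of_table :
    Commute (incl E2) Cas ∧ Commute (incl F2) Cas ∧ Commute (incl E2) cub ∧
      Commute (incl F2) cub := by
  obtain ⟨h1, h2, h3, h4, h5, h6, h7, h8, h9, h10, h11, h12, h13, h14, h15, h16, h17, h18, h19, h20,
    h21, h22, h23, h24, h25, h26, h27, h28⟩ := lie_table
  have t (X Y Z : sl3) (h : ⁅X, Y⁆ = Z) :=
    (incl_mul_comm X Y).trans (congrArg (fun w => incl Y * incl X + incl w) h)
  have s (X Y Z : sl3) (h : ⁅X, Y⁆ = Z) (u : Ug) :=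
    (incl_mul_comm_assoc X Y u).trans (congrArg (fun w => incl Y * (incl X * u) + incl w * u) h)
  refine ⟨?_, ?_, ?_, ?_⟩ <;> rw [commute_iff_eq] <;>
  simp only [Cas_eq, cub, aT_eq, bT, cT, dT, pow_succ, pow_zero, one_mul, two_mul, mul_add, add_mul,
    mul_sub, sub_mul, smul_mul_assoc, mul_smul_comm, smul_smul, smul_add, smul_sub, mul_assoc,
    mul_neg, neg_mul, smul_neg,
    t _ _ _ h1, t _ _ _ h2, t _ _ _ h3, t _ _ _ h4, t _ _ _ h5, t _ _ _ h6, t _ _ _ h7, t _ _ _ h8,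
    t _ _ _ h9, t _ _ _ h10, t _ _ _ h11, t _ _ _ h12, t _ _ _ h13, t _ _ _ h14, t _ _ _ h15,
    t _ _ _ h16, t _ _ _ h17, t _ _ _ h18, t _ _ _ h19, t _ _ _ h20, t _ _ _ h21, t _ _ _ h22,
    t _ _ _ h23, t _ _ _ h24, t _ _ _ h25, t _ _ _ h26, t _ _ _ h27, t _ _ _ h28,
    s _ _ _ h1, s _ _ _ h2, s _ _ _ h3, s _ _ _ h4, s _ _ _ h5, s _ _ _ h6, s _ _ _ h7, s _ _ _ h8,
    s _ _ _ h9, s _ _ _ h10, s _ _ _ h11, s _ _ _ h12, s _ _ _ h13, s _ _ _ h14, s _ _ _ h15,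
    s _ _ _ h16, s _ _ _ h17, s _ _ _ h18, s _ _ _ h19, s _ _ _ h20, s _ _ _ h21, s _ _ _ h22,
    s _ _ _ h23, s _ _ _ h24, s _ _ _ h25, s _ _ _ h26, s _ _ _ h27, s _ _ _ h28,
    map_add, map_sub, map_smul, map_neg, map_zero, zero_mul, mul_zero, add_zero, zero_add] <;>
  module

/-! ### Invariance of the explicit elements under `K` -/

theorem AdU_incl (g : Matrix.SpecialLinearGroup (Fin 3) ℂ) (X : sl3) :
    AdU g (incl X) = incl (Ad g X) :=
  UniversalEnvelopingAlgebra.lift_ι_apply ℂ (incl.comp (Ad g)) X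

theorem Ad_val (g : Matrix.SpecialLinearGroup (Fin 3) ℂ) (X : sl3) :
    (Ad g X).1 = g.1 * X.1 * g.1.adjugate := by
  rw [← Matrix.SpecialLinearGroup.coe_inv]; rfl

theorem det_of_isBlockDiag (g : Matrix.SpecialLinearGroup (Fin 3) ℂ) (hg : IsBlockDiag g.1) :
    g.1 2 2 * (g.1 0 0 * g.1 1 1 - g.1 0 1 * g.1 1 0) = 1 := by
  obtain ⟨h1, h2, h3, h4⟩ := hg
  have := g.2
  rw [Matrix.det_fin_three, h1, h2, h3, h4] at this
  linear_combination this

/-- The inverse of g is its adjugate, so the coefficients are polynomial in the entries of g. The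
determinant of the upper block is the inverse of the lower right entry. -/
theorem Ad_table (g : Matrix.SpecialLinearGroup (Fin 3) ℂ) (hg : IsBlockDiag g.1) :
    Ad g HA = HA ∧
    Ad g H = (g.1 2 2 * (g.1 0 0 * g.1 1 1 + g.1 0 1 * g.1 1 0)) • H
      - (2 * g.1 2 2 * g.1 0 0 * g.1 0 1) • E + (2 * g.1 2 2 * g.1 1 0 * g.1 1 1) • F ∧
    Ad g E = -(g.1 2 2 * g.1 0 0 * g.1 1 0) • H + (g.1 2 2 * g.1 0 0 ^ 2) • E
      - (g.1 2 2 * g.1 1 0 ^ 2) • F ∧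
    Ad g F = (g.1 2 2 * g.1 0 1 * g.1 1 1) • H - (g.1 2 2 * g.1 0 1 ^ 2) • E
      + (g.1 2 2 * g.1 1 1 ^ 2) • F ∧
    Ad g E1 = (g.1 0 0 * g.1 1 1 - g.1 0 1 * g.1 1 0) • (g.1 0 0 • E1 + g.1 1 0 • E2) ∧
    Ad g E2 = (g.1 0 0 * g.1 1 1 - g.1 0 1 * g.1 1 0) • (g.1 0 1 • E1 + g.1 1 1 • E2) ∧
    Ad g F1 = g.1 2 2 ^ 2 • (g.1 1 1 • F1 - g.1 0 1 • F2) ∧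
    Ad g F2 = g.1 2 2 ^ 2 • (g.1 0 0 • F2 - g.1 1 0 • F1) := by
  have hd := det_of_isBlockDiag g hg
  obtain ⟨h1, h2, h3, h4⟩ := hg
  refine ⟨?_, ?_, ?_, ?_, ?_, ?_, ?_, ?_⟩ <;> apply ext_coord <;> intro i <;> rw [Ad_val] <;>
    fin_cases i <;>
    simp [coord, HA_val, H_val, E_val, F_val, E1_val, E2_val, F1_val, F2_val, h1, h2, h3, h4,
      Matrix.adjugate_fin_three, Matrix.mul_apply, Fin.sum_univ_three] <;>
    first | ring1 | linear_combination (-2 / 3) * hd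

/-- The four elements come from invariant tensors: after expansion the coefficients of each word
agree, with no commutation relation needed. -/
theorem AdU_fixes (g : Matrix.SpecialLinearGroup (Fin 3) ℂ) (hg : IsBlockDiag g.1) :
    AdU g aT = aT ∧ AdU g bT = bT ∧ AdU g cT = cT ∧ AdU g dT = dT := by
  obtain ⟨hA, hH, hE, hF, hE1, hE2, hF1, hF2⟩ := Ad_table g hg
  have hd := det_of_isBlockDiag g hg
  generalize g.1 0 0 = p at *
  generalize g.1 0 1 = q at *
  generalize g.1 1 0 = r at *
  generalize g.1 1 1 = s at *
  generalize g.1 2 2 = z at *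
  have h0 : p * s - q * r ≠ 0 := right_ne_zero_of_mul_eq_one hd
  obtain rfl : z = (p * s - q * r)⁻¹ := eq_inv_of_mul_eq_one_left hd
  refine ⟨?_, ?_, ?_, ?_⟩ <;>
    simp only [aT_eq, bT, cT, dT, map_add, map_sub, map_mul, AdU_incl, hA, hH,
      hE, hF, hE1, hE2, hF1, hF2, map_smul, pow_two (incl _), two_mul,
      mul_add, add_mul, mul_sub, sub_mul,
      smul_mul_assoc, mul_smul_comm, smul_smul, smul_add, smul_sub, mul_assoc] <;>
    match_scalars <;> field_simp <;> ring

theorem generators_mem_UgK : aT ∈ UgK ∧ bT ∈ UgK ∧ cT ∈ UgK ∧ dT ∈ UgK := by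
  simp only [mem_UgK]
  exact ⟨fun g hg => (AdU_fixes g hg.2).1, fun g hg => (AdU_fixes g hg.2).2.1,
    fun g hg => (AdU_fixes g hg.2).2.2.1, fun g hg => (AdU_fixes g hg.2).2.2.2⟩

/-! ### Words in the basis -/

theorem adjoin_range_ι_eq_top (L : Type*) [LieRing L] [LieAlgebra ℂ L] :
    Algebra.adjoin ℂ (Set.range (UniversalEnvelopingAlgebra.ι ℂ : L → _)) = ⊤ := by
  rw [eq_top_iff]
  rintro u -
  obtain ⟨t, rfl⟩ : ∃ t, UniversalEnvelopingAlgebra.mkAlgHom ℂ L t = u :=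
    Quotient.exists_rep u
  have : t ∈ Algebra.adjoin ℂ (Set.range (TensorAlgebra.ι ℂ (M := L))) := by
    rw [TensorAlgebra.adjoin_range_ι]; trivial
  have h := Subalgebra.mem_map.mpr
    ⟨t, this, show (UniversalEnvelopingAlgebra.mkAlgHom ℂ L : _ →ₐ[ℂ] _) t = _ from rfl⟩
  rw [AlgHom.map_adjoin, ← Set.range_comp] at h
  exact h

/-- The product in `U(𝔤)` of a list of basis elements. -/
def word (l : List (Fin 8)) : Ug := (l.map fun i => incl (bas i)).prod

@[simp] theorem word_nil : word [] = 1 := rfl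

@[simp] theorem word_cons (i : Fin 8) (l : List (Fin 8)) :
    word (i :: l) = incl (bas i) * word l := by simp [word]

theorem word_append (l l' : List (Fin 8)) : word (l ++ l') = word l * word l' := by simp [word]

theorem incl_eq_sum (X : sl3) : incl X = ∑ i, coord i X.1 • incl (bas i) := by
  conv_lhs => rw [← sum_coord X]
  simp only [map_sum, map_smul]

theorem span_word_eq_top : Submodule.span ℂ (Set.range word) = ⊤ := by
  have h : Submodule.span ℂ (Set.range fun i => incl (bas i)) = LinearMap.range (incl : sl3 →ₗ[ℂ] Ug) := by
    apply le_antisymm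
    · rw [Submodule.span_le]
      rintro _ ⟨i, rfl⟩
      exact ⟨bas i, rfl⟩
    · rintro _ ⟨X, rfl⟩
      change incl X ∈ _
      rw [incl_eq_sum]
      exact Submodule.sum_mem _ fun i _ =>
        Submodule.smul_mem _ _ (Submodule.subset_span ⟨i, rfl⟩)
  have h2 : Algebra.adjoin ℂ (Set.range fun i => incl (bas i)) = ⊤ := by
    rw [← Algebra.adjoin_span, h]
    exact adjoin_range_ι_eq_top sl3
  rw [eq_top_iff, ← Algebra.top_toSubmodule, ← h2, Algebra.adjoin_eq_span, Submodule.span_le]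
  intro u hu
  obtain ⟨l, hl, rfl⟩ := Submonoid.exists_list_of_mem_closure hu
  choose! f hf using hl
  refine Submodule.subset_span ⟨l.map f, ?_⟩
  rw [word, List.map_map]
  congr 1
  conv_rhs => rw [← List.map_id l]
  exact List.map_congr_left fun x hx => hf x hx

/-! ### `K`-invariants commute with `𝔨` -/

/-- Words are joint eigenvectors, of weight m for ad Y and of eigenvalue ζ ^ m for Ad g. As ζ is not
a root of unity, the eigenvalue determines the weight, and an element fixed by Ad g has only its
weight zero component. -/
theorem commute_of_AdU_eq (Y : sl3) (g : Matrix.SpecialLinearGroup (Fin 3) ℂ) (ζ : ℂ)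
    (hζ0 : ζ ≠ 0) (hζ : ∀ n : ℤ, ζ ^ n = 1 → n = 0) (n : Fin 8 → ℤ)
    (hY : ∀ i, ⁅Y, bas i⁆ = (n i : ℂ) • bas i) (hg : ∀ i, Ad g (bas i) = ζ ^ n i • bas i) (u : Ug)
    (hu : AdU g u = u) : Commute (incl Y) u := by
  let W (m : ℤ) : Submodule ℂ Ug :=
    Module.End.eigenspace (LinearMap.mulLeft ℂ (incl Y) - LinearMap.mulRight ℂ (incl Y)) (m : ℂ) ⊓
      Module.End.eigenspace (AdU g).toLinearMap (ζ ^ m)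
  have hW (m : ℤ) (w : Ug) : w ∈ W m ↔ incl Y * w - w * incl Y = (m : ℂ) • w ∧
      AdU g w = ζ ^ m • w := by
    simp [W, Submodule.mem_inf]
  have hword (l : List (Fin 8)) : word l ∈ W (l.map n).sum := by
    induction l with
    | nil => rw [hW]; simp
    | cons i l ih =>
      rw [hW] at ih ⊢
      obtain ⟨ih1, ih2⟩ := ih
      have h1 := incl_mul_comm Y (bas i)
      rw [hY, map_smul] at h1
      refine ⟨?_, ?_⟩
      · rw [word_cons, ← mul_assoc, h1, add_mul, mul_assoc, sub_eq_iff_eq_add.mp ih1]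
        simp only [mul_add, smul_mul_assoc, mul_smul_comm, List.map_cons, List.sum_cons, mul_assoc]
        push_cast
        module
      · rw [word_cons, map_mul, AdU_incl, hg, ih2, map_smul, List.map_cons, List.sum_cons,
          zpow_add₀ hζ0, smul_mul_smul_comm]
  have hsup : u ∈ ⨆ m, W m := by
    have : (⊤ : Submodule ℂ Ug) ≤ ⨆ m, W m := by
      rw [← span_word_eq_top, Submodule.span_le]
      rintro _ ⟨l, rfl⟩
      exact Submodule.mem_iSup_of_mem _ (hword l)
    exact this trivial
  obtain ⟨f, hf, rfl⟩ := (Submodule.mem_iSup_iff_exists_finsupp W u).mp hsup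
  have hinj : Function.Injective fun m : ℤ => ζ ^ m := fun a b hab => by
    have := hζ (a - b) (by rw [zpow_sub₀ hζ0]; exact div_eq_one_iff_eq (zpow_ne_zero _ hζ0) |>.mpr hab)
    omega
  have hind := (Module.End.eigenspaces_iSupIndep (AdU g).toLinearMap).comp hinj
  rw [iSupIndep_iff_finsetSum_eq_zero_imp_eq_zero] at hind
  -- These vectors sum to `AdU g u - u = 0` and lie in independent eigenspaces.
  have hz : ∀ m, (ζ ^ m - 1) • f m = 0 := by
    intro m
    by_cases hm : m ∈ f.support
    · refine hind f.support (fun m => (ζ ^ m - 1) • f m) (fun m _ => ?_) ?_ m hm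
      · exact Submodule.smul_mem _ _ (Submodule.mem_inf.mp (hf m)).2
      · simp only [sub_smul, one_smul, Finset.sum_sub_distrib]
        rw [sub_eq_zero]
        refine Eq.trans ?_ hu
        rw [Finsupp.sum, map_sum]
        exact Finset.sum_congr rfl fun m _ => ((hW m _).mp (hf m)).2.symm
    · rw [Finsupp.notMem_support_iff.mp hm, smul_zero]
  rw [Finsupp.sum]
  refine Commute.sum_right _ _ _ fun m hm => ?_
  have hm0 : m = 0 := by
    have := (smul_eq_zero.mp (hz m)).resolve_right (Finsupp.mem_support_iff.mp hm)
    exact hζ m (sub_eq_zero.mp this)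
  have := ((hW m _).mp (hf m)).1
  rw [hm0, Int.cast_zero, zero_smul, sub_eq_zero] at this
  rw [hm0]
  exact this

/-- The block diagonal matrix with upper left block `(p, q; r, s)`, lower right entry `z`. -/
def blockSL (p q r s z : ℂ) (h : z * (p * s - q * r) = 1) :
    Matrix.SpecialLinearGroup (Fin 3) ℂ :=
  ⟨!![p, q, 0; r, s, 0; 0, 0, z], by simp [Matrix.det_fin_three]; linear_combination h⟩

theorem blockSL_mem_K {p q r s z : ℂ} (h : z * (p * s - q * r) = 1)
    (h1 : star p * p + star r * r = 1) (h2 : star q * q + star s * s = 1)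
    (h3 : star p * q + star r * s = 0) (h4 : star z * z = 1) : blockSL p q r s z h ∈ K := by
  have h5 : star q * p + star s * r = 0 := by
    have := congrArg star h3
    simp only [star_add, star_mul', star_star, star_zero] at this
    linear_combination this
  refine ⟨?_, by simp [blockSL, IsBlockDiag]⟩
  simp only [RCLike.star_def] at h1 h2 h3 h4 h5
  ext i j
  fin_cases i <;> fin_cases j <;>
    simp [blockSL, Matrix.mul_apply, Fin.sum_univ_three, h1, h2, h3, h4, h5]

/-- A relation n = 2πm with n ≠ 0 would make π rational. -/
theorem exp_I_zpow_eq_one {n : ℤ} (h : Complex.exp Complex.I ^ n = 1) : n = 0 := by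
  rw [← Complex.exp_int_mul, Complex.exp_eq_one_iff] at h
  obtain ⟨m, hm⟩ := h
  have h1 : (n : ℂ) = m * (2 * Real.pi) := by
    apply mul_right_cancel₀ Complex.I_ne_zero
    linear_combination hm
  have h2 : (n : ℝ) = m * (2 * Real.pi) := by exact_mod_cast h1
  by_contra hn
  have hm0 : (m : ℝ) ≠ 0 := by
    rintro h0
    rw [h0, zero_mul] at h2
    exact hn (by exact_mod_cast h2)
  refine irrational_pi ⟨(n / (2 * m) : ℚ), ?_⟩
  push_cast
  field_simp
  linear_combination h2

theorem star_exp_I : star (Complex.exp Complex.I) = (Complex.exp Complex.I)⁻¹ := by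
  rw [Complex.star_def, ← Complex.exp_conj, Complex.conj_I, Complex.exp_neg]

theorem commute_torus_of_mem_UgK {u : Ug} (hu : u ∈ UgK) :
    Commute (incl HA) u ∧ Commute (incl H) u := by
  rw [mem_UgK] at hu
  have hz0 := Complex.exp_ne_zero Complex.I
  have hs := star_exp_I
  have hone := @exp_I_zpow_eq_one
  set z := Complex.exp Complex.I
  obtain ⟨h1, h2, h3, h4, h5, h6, h7, h8, h9, h10, h11, h12, h13, h14, h15, h16, h17, h18, h19, h20,
    h21, h22, h23, h24, h25, h26, h27, h28⟩ := lie_table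
  constructor
  -- The matrix diag(z, z, z⁻²) scales E₁, E₂ by z³ and F₁, F₂ by z⁻³; hence the parameter z³ for
  -- the weights of HA.
  · have hd : (z ^ 2)⁻¹ * (z * z - 0 * 0) = 1 := by field_simp; ring
    have hK : blockSL z 0 0 z (z ^ 2)⁻¹ hd ∈ K :=
      blockSL_mem_K hd (by simp [hs, hz0]) (by simp [hs, hz0]) (by simp) (by
        rw [star_inv₀, star_pow, hs]; field_simp)
    obtain ⟨tA, tH, tE, tF, tE1, tE2, tF1, tF2⟩ := Ad_table _ hK.2
    refine commute_of_AdU_eq HA _ (z ^ 3) (pow_ne_zero 3 hz0) (fun n hn => ?_)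
      ![0, 0, 0, 0, 1, 1, -1, -1] (fun i => ?_) (fun i => ?_) u (hu _ hK)
    · have := @hone (3 * n) (by rw [zpow_mul]; exact_mod_cast hn)
      omega
    · rw [← lie_skew]
      fin_cases i <;> simp [bas, *]
    · fin_cases i <;> simp [bas, *] <;> simp [blockSL] <;> match_scalars <;> field_simp
  -- The matrix diag(z, z⁻¹, 1) acts by z to the weights of H.
  · have hd : 1 * (z * z⁻¹ - 0 * 0) = 1 := by field_simp; ring
    have hK : blockSL z 0 0 z⁻¹ 1 hd ∈ K :=
      blockSL_mem_K hd (by simp [hs, hz0]) (by simp [hs, hz0]) (by simp) (by simp)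
    obtain ⟨tA, tH, tE, tF, tE1, tE2, tF1, tF2⟩ := Ad_table _ hK.2
    refine commute_of_AdU_eq H _ z hz0 (fun n hn => hone hn)
      ![0, 0, 2, -2, 1, -1, -1, 1] (fun i => ?_) (fun i => ?_) u (hu _ hK)
    · rw [← lie_skew]
      fin_cases i <;> simp [bas, *]
    · fin_cases i <;> simp [bas, *] <;> simp [blockSL] <;> match_scalars <;> field_simp

theorem commute_k_of_mem_UgK {u : Ug} (hu : u ∈ UgK) :
    Commute (incl HA) u ∧ Commute (incl H) u ∧ Commute (incl E) u ∧ Commute (incl F) u := by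
  obtain ⟨hA, hH⟩ := commute_torus_of_mem_UgK hu
  rw [mem_UgK] at hu
  -- Applying Ad g to the relation between H and u shows that Ad g H commutes with u; removing its
  -- H-component leaves a combination of E and F.
  have key (q r : ℂ) (h : 1 * (3 / 5 * (3 / 5) - q * r) = 1)
      (h1 : star q * q = 16 / 25) (h2 : star r * r = 16 / 25) (h3 : q + star r = 0) :
      Commute ((-2 * (3 / 5) * q) • incl E + (2 * (3 / 5) * r) • incl F) u := by
    have h35 : star (3 / 5 : ℂ) = 3 / 5 := by simp
    have hK : blockSL (3 / 5) q r (3 / 5) 1 h ∈ K :=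
      blockSL_mem_K h (by rw [h35, h2]; norm_num) (by rw [h35, h1]; norm_num)
        (by rw [h35]; linear_combination (3 / 5) * h3) (by simp)
    have h4 := congrArg (AdU (blockSL (3 / 5) q r (3 / 5) 1 h)) hH.eq
    rw [map_mul, map_mul, hu _ hK, AdU_incl, (Ad_table _ hK.2).2.1] at h4
    have h5 : Commute (incl _) u := h4
    simp only [blockSL, Matrix.of_apply, Matrix.cons_val, map_add, map_sub, map_smul] at h5
    have h6 := h5.sub_left (hH.smul_left (1 * (3 / 5 * (3 / 5) + q * r)))
    convert h6 using 1
    module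
  have hI : star (4 / 5 * Complex.I) = -(4 / 5 * Complex.I) := by simp
  -- The triple 3, 4, 5 gives unitary matrices with rational moduli. The real one yields (24/25)(E +
  -- F), the imaginary one, after multiplication by I, (24/25)(E - F); hence the factor 25/48 below.
  have k1 := key (-4 / 5) (4 / 5) (by norm_num) (by simp; norm_num) (by simp; norm_num)
    (by simp; norm_num)
  have k2 := key (4 / 5 * Complex.I) (4 / 5 * Complex.I)
    (by linear_combination (-16 / 25) * Complex.I_sq)
    (by rw [hI]; linear_combination (-16 / 25) * Complex.I_sq)
    (by rw [hI]; linear_combination (-16 / 25) * Complex.I_sq) (by rw [hI]; ring)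
  have k3 := k2.smul_left Complex.I
  refine ⟨hA, hH, ?_, ?_⟩
  · convert (k1.add_left k3).smul_left (25 / 48 : ℂ) using 1
    match_scalars <;> ring_nf <;> rw [Complex.I_sq] <;> ring
  · convert (k1.sub_left k3).smul_left (25 / 48 : ℂ) using 1
    match_scalars <;> ring_nf <;> rw [Complex.I_sq] <;> ring

/-! ### Symbols -/

/-- The symmetric algebra of `𝔤`, as a polynomial ring in the basis elements. -/
abbrev Sg : Type := MvPolynomial (Fin 8) ℂ

/-- The canonical map `𝔤 → S(𝔤)`. -/
def lin : sl3 →ₗ[ℂ] Sg :=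
  ∑ i, (LinearMap.toSpanSingleton ℂ Sg (MvPolynomial.X i)).comp
    ((coord i).comp sl3.toSubmodule.subtype)

theorem lin_apply (X : sl3) : lin X = ∑ i, coord i X.1 • (MvPolynomial.X i : Sg) := by
  simp only [lin, LinearMap.sum_apply]
  rfl

theorem lin_bas (i : Fin 8) : lin (bas i) = MvPolynomial.X i := by
  simp [lin_apply, coord_bas]

/-- The derivation of `S(𝔤)` that extends `ad X`. -/
def adS (X : sl3) : Derivation ℂ Sg Sg := MvPolynomial.mkDerivation ℂ fun i => lin ⁅X, bas i⁆

theorem adS_X (X : sl3) (i : Fin 8) : adS X (MvPolynomial.X i) = lin ⁅X, bas i⁆ :=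
  MvPolynomial.mkDerivation_X ..

/-- The product in `S(𝔤)` of a list of basis elements. -/
def mon (l : List (Fin 8)) : Sg := (l.map MvPolynomial.X).prod

@[simp] theorem mon_nil : mon [] = 1 := rfl

@[simp] theorem mon_cons (i : Fin 8) (l : List (Fin 8)) :
    mon (i :: l) = MvPolynomial.X i * mon l := by simp [mon]

theorem mon_append (l l' : List (Fin 8)) : mon (l ++ l') = mon l * mon l' := by simp [mon]

/-- The filtration of `U(𝔤)`: the span of the products of less than `n` basis elements. -/
def fil (n : ℕ) : Submodule ℂ Ug := Submodule.span ℂ (word '' {l | l.length < n})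

theorem word_mem_fil {l : List (Fin 8)} {n : ℕ} (h : l.length < n) : word l ∈ fil n :=
  Submodule.subset_span ⟨l, h, rfl⟩

theorem fil_mono {m n : ℕ} (h : m ≤ n) : fil m ≤ fil n :=
  Submodule.span_mono (Set.image_mono fun _ hl => lt_of_lt_of_le hl h)

theorem exists_mem_fil (u : Ug) : ∃ n, u ∈ fil n := by
  have h : u ∈ Submodule.span ℂ (Set.range word) := span_word_eq_top ▸ trivial
  induction h using Submodule.span_induction with
  | mem _ hx =>
    obtain ⟨l, rfl⟩ := hx
    exact ⟨_, word_mem_fil (Nat.lt_succ_self _)⟩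
  | zero => exact ⟨0, zero_mem _⟩
  | add x y _ _ hx hy =>
    obtain ⟨m, hm⟩ := hx
    obtain ⟨n, hn⟩ := hy
    exact ⟨max m n, add_mem (fil_mono (le_max_left _ _) hm) (fil_mono (le_max_right _ _) hn)⟩
  | smul c x _ hx =>
    obtain ⟨m, hm⟩ := hx
    exact ⟨m, Submodule.smul_mem _ c hm⟩

theorem word_mul_mem_fil (l : List (Fin 8)) {n : ℕ} {u : Ug} (hu : u ∈ fil n) :
    word l * u ∈ fil (l.length + n) := by
  have : fil n ≤ (fil (l.length + n)).comap (LinearMap.mulLeft ℂ (word l)) := by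
    rw [fil, Submodule.span_le]
    rintro _ ⟨l', hl', rfl⟩
    change word l * word l' ∈ fil _
    rw [← word_append]
    refine word_mem_fil ?_
    rw [List.length_append]
    exact Nat.add_lt_add_left hl' _
  exact this hu

theorem mul_word_mem_fil (l : List (Fin 8)) {n : ℕ} {u : Ug} (hu : u ∈ fil n) :
    u * word l ∈ fil (n + l.length) := by
  have : fil n ≤ (fil (n + l.length)).comap (LinearMap.mulRight ℂ (word l)) := by
    rw [fil, Submodule.span_le]
    rintro _ ⟨l', hl', rfl⟩
    change word l' * word l ∈ fil _
    rw [← word_append]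
    refine word_mem_fil ?_
    rw [List.length_append]
    exact Nat.add_lt_add_right hl' _
  exact this hu

theorem incl_mem_fil (X : sl3) : incl X ∈ fil 2 := by
  rw [incl_eq_sum]
  refine Submodule.sum_mem _ fun i _ => Submodule.smul_mem _ _ ?_
  have := word_mem_fil (l := [i]) (n := 2) (by simp)
  simpa using this

/-- Reordering the factors of a product changes it by terms of lower order. -/
theorem word_sub_word_mem_fil {l l' : List (Fin 8)} (h : l.Perm l') :
    word l - word l' ∈ fil l.length := by
  induction h with
  | nil => simp
  | cons x h ih =>
    have := word_mul_mem_fil [x] ih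
    rw [word_cons, word_cons, ← mul_sub]
    simpa [add_comm] using this
  | swap x y l =>
    -- The swap costs one bracket, which is a single factor in place of two.
    have h1 := mul_word_mem_fil l (incl_mem_fil ⁅bas y, bas x⁆)
    simp only [word_cons]
    rw [incl_mul_comm_assoc (bas y), add_sub_cancel_left,
      show (y :: x :: l).length = 2 + l.length by simp only [List.length_cons]; omega]
    exact h1
  | trans h1 _ ih1 ih2 =>
    rw [← h1.length_eq] at ih2
    simpa using add_mem ih1 ih2

/-- The pairs that span the symbol relation of order `n`. -/
def symGen (n : ℕ) : Set (Sg × Ug) :=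
  {w | ∃ l : List (Fin 8), l.length = n ∧ w = (mon l, word l)} ∪
    {w | ∃ l : List (Fin 8), l.length < n ∧ w = (0, word l)}

/-- The relation `p is a symbol of order n of u` between `p ∈ S(𝔤)` and `u ∈ U(𝔤)`. -/
def sym (n : ℕ) : Submodule ℂ (Sg × Ug) := Submodule.span ℂ (symGen n)

theorem sym_mul {m n : ℕ} {w w' : Sg × Ug} (hw : w ∈ sym m) (hw' : w' ∈ sym n) :
    w * w' ∈ sym (m + n) := by
  have h : sym m * sym n ≤ sym (m + n) := by
    rw [sym, sym, Submodule.span_mul_span, sym]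
    refine Submodule.span_mono ?_
    rintro _ ⟨_, ⟨l, hl, rfl⟩ | ⟨l, hl, rfl⟩, _, ⟨l', hl', rfl⟩ | ⟨l', hl', rfl⟩, rfl⟩
    · exact Or.inl ⟨l ++ l', by simp [hl, hl'], by simp [word_append, mon_append]⟩
    · exact Or.inr ⟨l ++ l', by rw [List.length_append]; omega, by simp [word_append]⟩
    · exact Or.inr ⟨l ++ l', by rw [List.length_append]; omega, by simp [word_append]⟩
    · exact Or.inr ⟨l ++ l', by rw [List.length_append]; omega, by simp [word_append]⟩
  exact h (Submodule.mul_mem_mul hw hw')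

theorem zero_mem_sym {n : ℕ} {u : Ug} (hu : u ∈ fil n) : ((0, u) : Sg × Ug) ∈ sym n := by
  have : fil n ≤ (sym n).comap (LinearMap.inr ℂ Sg Ug) := by
    rw [fil, Submodule.span_le]
    rintro _ ⟨l, hl, rfl⟩
    exact Submodule.subset_span (Or.inr ⟨l, hl, rfl⟩)
  exact this hu

theorem snd_mem_fil_of_mem_sym {n : ℕ} {w : Sg × Ug} (hw : w ∈ sym n) : w.2 ∈ fil (n + 1) := by
  have : sym n ≤ (fil (n + 1)).comap (LinearMap.snd ℂ Sg Ug) := by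
    rw [sym, Submodule.span_le]
    rintro _ (⟨l, hl, rfl⟩ | ⟨l, hl, rfl⟩)
    · exact word_mem_fil (hl ▸ Nat.lt_succ_self _)
    · exact word_mem_fil (hl.trans (Nat.lt_succ_self _))
  exact this hw

theorem mon_word_mem_sym (l : List (Fin 8)) : (mon l, word l) ∈ sym l.length :=
  Submodule.subset_span (Or.inl ⟨l, rfl, rfl⟩)

theorem one_mem_sym : (1 : Sg × Ug) ∈ sym 0 := mon_word_mem_sym []

theorem lin_mem_sym (X : sl3) : (lin X, incl X) ∈ sym 1 := by
  have : (lin X, incl X) = ∑ i, coord i X.1 • (mon [i], word [i]) := by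
    ext1
    · simp [lin_apply, Prod.fst_sum]
    · simp only [Prod.snd_sum, Prod.smul_snd, word_cons, word_nil, mul_one]
      exact incl_eq_sum X
  rw [this]
  exact Submodule.sum_mem _ fun i _ => Submodule.smul_mem _ _ (mon_word_mem_sym [i])

theorem exists_mem_sym {n : ℕ} {u : Ug} (hu : u ∈ fil (n + 1)) : ∃ p, (p, u) ∈ sym n := by
  have : fil (n + 1) ≤ (sym n).map (LinearMap.snd ℂ Sg Ug) := by
    rw [fil, Submodule.span_le]
    rintro _ ⟨l, hl, rfl⟩
    rcases Nat.lt_succ_iff_lt_or_eq.mp hl with h | rfl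
    · exact ⟨(0, word l), zero_mem_sym (word_mem_fil h), rfl⟩
    · exact ⟨(mon l, word l), mon_word_mem_sym l, rfl⟩
  obtain ⟨w, hw, rfl⟩ := this hu
  exact ⟨w.1, hw⟩

theorem isHomogeneous_of_mem_sym {n : ℕ} {w : Sg × Ug} (hw : w ∈ sym n) :
    w.1.IsHomogeneous n := by
  have : sym n ≤ (MvPolynomial.homogeneousSubmodule (Fin 8) ℂ n).comap (LinearMap.fst ℂ Sg Ug) := by
    rw [sym, Submodule.span_le]
    rintro _ (⟨l, rfl, rfl⟩ | ⟨l, hl, rfl⟩)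
    · change (mon l).IsHomogeneous _
      clear hw
      induction l with
      | nil => exact MvPolynomial.isHomogeneous_one _ _
      | cons i l ih =>
        rw [mon_cons, List.length_cons, add_comm]
        exact (MvPolynomial.isHomogeneous_X ℂ i).mul ih
    · exact zero_mem (MvPolynomial.homogeneousSubmodule (Fin 8) ℂ n)
  exact this hw

/-- The symbol map is compatible with the adjoint action. -/
theorem ad_mem_sym (X : sl3) {n : ℕ} {w : Sg × Ug} (hw : w ∈ sym n) :
    (adS X w.1, incl X * w.2 - w.2 * incl X) ∈ sym n := by
  have hl (l : List (Fin 8)) :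
      (adS X (mon l), incl X * word l - word l * incl X) ∈ sym l.length := by
    induction l with
    | nil =>
      simp only [mon_nil, word_nil, Derivation.map_one_eq_zero, mul_one, one_mul, sub_self]
      exact zero_mem _
    | cons i l ih =>
      have h1 := sym_mul (lin_mem_sym ⁅X, bas i⁆) (mon_word_mem_sym l)
      have h2 := sym_mul (mon_word_mem_sym [i]) ih
      have h3 := add_mem h1 h2
      rw [List.length_cons, add_comm]
      convert h3 using 1
      ext1
      · simp [adS_X]; ring
      · simp only [word_cons, Prod.snd_add, Prod.snd_mul, word_nil, mul_one]
        rw [← mul_assoc, incl_mul_comm X (bas i)]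
        noncomm_ring
  have : sym n ≤ (sym n).comap ((adS X).toLinearMap.prodMap
      (LinearMap.mulLeft ℂ (incl X) - LinearMap.mulRight ℂ (incl X))) := by
    conv_lhs => rw [sym]
    rw [Submodule.span_le]
    rintro _ (⟨l, rfl, rfl⟩ | ⟨l, h, rfl⟩)
    · exact hl l
    · change (adS X 0, incl X * word l - word l * incl X) ∈ sym n
      rw [map_zero]
      -- The commutator with a shorter word has no larger order than that word, so it stays in `fil
      -- n`.
      exact zero_mem_sym (fil_mono h (snd_mem_fil_of_mem_sym (hl l)))
  exact this hw

/-- An element with zero symbol of order `n` has order less than `n`. -/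
theorem mem_fil_of_zero_mem_sym {n : ℕ} {u : Ug} (hu : ((0, u) : Sg × Ug) ∈ sym n) :
    u ∈ fil n := by
  -- A linear section of the symbol: each monomial goes to one chosen ordering of its factors.
  -- Reordering shows `u - φ p ∈ fil n` on the whole relation, and p = 0 gives the claim.
  let φ : Sg →ₗ[ℂ] Ug := (MvPolynomial.basisMonomials (Fin 8) ℂ).constr ℂ
    fun m => word m.toMultiset.toList
  have hφ (l : List (Fin 8)) : ∃ l', l.Perm l' ∧ φ (mon l) = word l' := by
    refine ⟨(Multiset.toFinsupp (l : Multiset (Fin 8))).toMultiset.toList, ?_, ?_⟩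
    rotate_left
    · have : mon l = MvPolynomial.basisMonomials (Fin 8) ℂ (Multiset.toFinsupp (l : Multiset (Fin 8))) := by
        rw [MvPolynomial.coe_basisMonomials]
        induction l with
        | nil => simp
        | cons i l ih =>
          rw [mon_cons, ih, ← Multiset.cons_coe, ← Multiset.singleton_add, map_add,
            Multiset.toFinsupp_singleton, MvPolynomial.X, MvPolynomial.monomial_mul, one_mul]
      rw [this]
      exact Module.Basis.constr_basis ..
    · rw [← Multiset.coe_eq_coe, Multiset.coe_toList]
      exact (Multiset.toFinsupp_toMultiset _).symm
  have h : sym n ≤ (fil n).comap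
      (LinearMap.snd ℂ Sg Ug - φ.comp (LinearMap.fst ℂ Sg Ug)) := by
    rw [sym, Submodule.span_le]
    rintro _ (⟨l, rfl, rfl⟩ | ⟨l, h, rfl⟩)
    · obtain ⟨l', hp, he⟩ := hφ l
      change word l - φ (mon l) ∈ fil _
      rw [he]
      exact word_sub_word_mem_fil hp
    · change word l - φ 0 ∈ fil _
      rw [map_zero, sub_zero]
      exact word_mem_fil h
  have := h hu
  change u - φ 0 ∈ fil _ at this
  rwa [map_zero, sub_zero] at this

/-! ### Symbols are unique

For a linear form `ℓ` on the space of matrices, `X ∈ 𝔤` acts on sequences of polynomial functions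
of a matrix `x` by `∂_X + (∂_X ℓ) · shift`, where `∂_X` is the derivative in the direction `x X`. -/

/-- The polynomial functions on the space of `3 × 3` matrices. -/
abbrev MatPoly : Type := MvPolynomial (Fin 3 × Fin 3) ℂ

/-- The left invariant vector field `∂_X`. -/
def vf (X : Matrix (Fin 3) (Fin 3) ℂ) : Derivation ℂ MatPoly MatPoly :=
  MvPolynomial.mkDerivation ℂ fun ij => ∑ l, X l ij.2 • MvPolynomial.X (ij.1, l)

theorem vf_X (X : Matrix (Fin 3) (Fin 3) ℂ) (i j : Fin 3) :
    vf X (MvPolynomial.X (i, j)) = ∑ l, X l j • MvPolynomial.X (i, l) :=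
  MvPolynomial.mkDerivation_X ..

theorem vf_add (X Y : Matrix (Fin 3) (Fin 3) ℂ) : vf (X + Y) = vf X + vf Y := by
  refine MvPolynomial.derivation_ext fun ⟨i, j⟩ => ?_
  simp [vf_X, add_smul, Finset.sum_add_distrib]

theorem vf_smul (c : ℂ) (X : Matrix (Fin 3) (Fin 3) ℂ) : vf (c • X) = c • vf X := by
  refine MvPolynomial.derivation_ext fun ⟨i, j⟩ => ?_
  simp [vf_X, mul_smul, Finset.smul_sum]

theorem vf_commutator (X Y : Matrix (Fin 3) (Fin 3) ℂ) (f : MatPoly) :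
    vf (X * Y - Y * X) f = vf X (vf Y f) - vf Y (vf X f) := by
  have h : vf (X * Y - Y * X) = ⁅vf X, vf Y⁆ := by
    refine MvPolynomial.derivation_ext fun ⟨i, j⟩ => ?_
    simp only [Derivation.commutator_apply, vf_X, Fin.sum_univ_three, map_add, Derivation.map_smul,
      Matrix.sub_apply, Matrix.mul_apply]
    module
  rw [h, Derivation.commutator_apply]

/-- The operator `∂_X + (∂_X ℓ) · shift`. -/
def rhoFun (ℓ : MatPoly) (X : Matrix (Fin 3) (Fin 3) ℂ) (f : ℕ → MatPoly) : ℕ → MatPoly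
  | 0 => vf X (f 0)
  | n + 1 => vf X (f (n + 1)) + vf X ℓ * f n

/-- The representation of `𝔤` by the operators `rhoFun`. -/
def rho (ℓ : MatPoly) : sl3 →ₗ⁅ℂ⁆ Module.End ℂ (ℕ → MatPoly) where
  toFun X :=
    { toFun := rhoFun ℓ X.1
      map_add' := fun f g => by
        funext n
        cases n <;> simp [rhoFun]
        ring
      map_smul' := fun c f => by
        funext n
        cases n <;> simp [rhoFun] }
  map_add' X Y := by
    ext1 f
    funext n
    cases n <;> simp [rhoFun, vf_add]
    ring
  map_smul' c X := by
    ext1 f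
    funext n
    cases n <;> simp [rhoFun, vf_smul]
  map_lie' {X Y} := by
    ext1 f
    funext n
    rw [LieRing.of_associative_ring_bracket]
    change rhoFun ℓ (X.1 * Y.1 - Y.1 * X.1) f n =
      rhoFun ℓ X.1 (rhoFun ℓ Y.1 f) n - rhoFun ℓ Y.1 (rhoFun ℓ X.1 f) n
    -- A product of two operators reaches two places back, so indices 0 and 1 are separate. With the
    -- shift read as multiplication by t, the operator is ∂_X conjugated by exp(tℓ), which explains
    -- the bracket relation.
    rcases n with _ | _ | n <;>
      simp only [rhoFun, vf_commutator, map_add, Derivation.leibniz, smul_eq_mul, zero_add] <;> ring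

theorem rho_apply (ℓ : MatPoly) (X : sl3) (f : ℕ → MatPoly) : rho ℓ X f = rhoFun ℓ X.1 f := rfl

/-- The action of `U(𝔤)` that extends `rho`, applied to the sequence `1, 0, 0, …`. -/
def act (ℓ : MatPoly) : Ug →ₗ[ℂ] ℕ → MatPoly :=
  (LinearMap.applyₗ (Pi.single 0 1)).comp (UniversalEnvelopingAlgebra.lift ℂ (rho ℓ)).toLinearMap

/-- Each factor moves the sequence by at most one place, and a move contributes ∂_X ℓ. The entry at
index `l.length` therefore arises only when every factor moves. -/
theorem act_word (ℓ : MatPoly) (l : List (Fin 8)) :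
    (∀ m, l.length < m → act ℓ (word l) m = 0) ∧
      act ℓ (word l) l.length = (l.map fun i => vf (bas i).1 ℓ).prod := by
  induction l with
  | nil =>
    have h : act ℓ (word []) = Pi.single 0 1 := by simp [act]
    rw [h]
    exact ⟨fun m hm => Pi.single_eq_of_ne (Nat.pos_iff_ne_zero.mp hm) _, by simp⟩
  | cons i l ih =>
    have h : act ℓ (word (i :: l)) = rhoFun ℓ (bas i).1 (act ℓ (word l)) := by
      rw [word_cons, ← rho_apply, ← UniversalEnvelopingAlgebra.lift_ι_apply ℂ (rho ℓ)]
      simp only [act, LinearMap.comp_apply, AlgHom.toLinearMap_apply, map_mul]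
      rfl
    obtain ⟨ih1, ih2⟩ := ih
    rw [h]
    constructor
    · rintro (_ | m) hm
      · omega
      · rw [List.length_cons] at hm
        rw [rhoFun, ih1 m (by omega), ih1 (m + 1) (by omega), map_zero, mul_zero, add_zero]
    · rw [List.length_cons, rhoFun, ih1 _ (Nat.lt_succ_self _), ih2, map_zero, zero_add,
        List.map_cons, List.prod_cons]

/-- A linear form that takes the value `v i` at the `i`-th basis element. -/
def form (v : Fin 8 → ℂ) : MatPoly :=
  -- The matrix units need not be traceless, so this uses that `coord` is defined on all matrices.
  ∑ i, ∑ j, (∑ a, v a * coord a (Matrix.single i j 1)) • MvPolynomial.X (i, j)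

/-- At the identity, the derivative of a linear form in the direction x X is its value at X. -/
theorem eval_vf_form (v : Fin 8 → ℂ) (a : Fin 8) :
    MvPolynomial.eval (fun ij => (1 : Matrix (Fin 3) (Fin 3) ℂ) ij.1 ij.2)
      (vf (bas a).1 (form v)) = v a := by
  have h (X : Matrix (Fin 3) (Fin 3) ℂ) :
      MvPolynomial.eval (fun ij => (1 : Matrix (Fin 3) (Fin 3) ℂ) ij.1 ij.2) (vf X (form v)) =
        ∑ a, v a * coord a X := by
    conv_rhs => rw [Matrix.matrix_eq_sum_single X]
    have hs (i j : Fin 3) : Matrix.single i j (X i j) = X i j • Matrix.single i j (1 : ℂ) := by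
      simp
    simp only [form, map_sum, Derivation.map_smul, vf_X, MvPolynomial.smul_eval,
      MvPolynomial.eval_X, hs, map_smul, Matrix.one_apply, smul_eq_mul, mul_ite, mul_one, mul_zero,
      Finset.sum_ite_eq, Finset.mem_univ, if_true, Finset.mul_sum, Finset.sum_mul]
    simp only [Fin.sum_univ_three, ← Finset.sum_add_distrib]
    exact Finset.sum_congr rfl fun a _ => by ring
  rw [h]
  simp [coord_bas]

/-- The right-hand side depends on the element of U(𝔤) alone, so that element determines all values
of its symbol. -/
theorem eval_fst_of_mem_sym (v : Fin 8 → ℂ) {n : ℕ} {w : Sg × Ug} (hw : w ∈ sym n) :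
    MvPolynomial.eval v w.1 =
      MvPolynomial.eval (fun ij => (1 : Matrix (Fin 3) (Fin 3) ℂ) ij.1 ij.2)
        (act (form v) w.2 n) := by
  induction hw using Submodule.span_induction with
  | mem w h =>
    obtain ⟨l, rfl, rfl⟩ | ⟨l, h, rfl⟩ := h
    · rw [(act_word (form v) l).2, map_list_prod, List.map_map, mon, map_list_prod, List.map_map]
      congr 1
      refine List.map_congr_left fun i _ => ?_
      simp [eval_vf_form]
    · rw [(act_word (form v) l).1 n h]
      simp
  | zero => simp
  | add x y _ _ hx hy => simp [hx, hy]
  | smul c x _ hx => simp [hx]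

/-- The Poincaré–Birkhoff–Witt theorem for `𝔤`, in the form: an element of order less than `n` has
symbol zero of order `n`. -/
theorem eq_zero_of_mem_sym {n : ℕ} {p : Sg} {u : Ug} (h : (p, u) ∈ sym n) (hu : u ∈ fil n) :
    p = 0 := by
  refine MvPolynomial.funext fun v => ?_
  have h1 := eval_fst_of_mem_sym v h
  have h2 := eval_fst_of_mem_sym v (zero_mem_sym hu)
  exact h1.trans h2.symm

/-! ### The `𝔨`-invariants in `S(𝔤)` -/

/-- A polynomial is constant along the integral curves of a derivation that annihilates it. -/
theorem eval_integralCurve {σ : Type*} {D : Derivation ℂ (MvPolynomial σ ℂ) (MvPolynomial σ ℂ)}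
    {γ : ℂ → σ → ℂ}
    (hγ : ∀ i s, HasDerivAt (fun t => γ t i) (MvPolynomial.eval (γ s) (D (MvPolynomial.X i))) s)
    {f : MvPolynomial σ ℂ} (hf : D f = 0) (s : ℂ) :
    MvPolynomial.eval (γ s) f = MvPolynomial.eval (γ 0) f := by
  have h (p : MvPolynomial σ ℂ) (s : ℂ) :
      HasDerivAt (fun t => MvPolynomial.eval (γ t) p) (MvPolynomial.eval (γ s) (D p)) s := by
    induction p using MvPolynomial.induction_on with
    | C a => simpa using hasDerivAt_const s a
    | add p q hp hq => simpa using hp.fun_add hq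
    | mul_X p i hp =>
      simp only [map_mul, MvPolynomial.eval_X, Derivation.leibniz, map_add, smul_eq_mul]
      refine (hp.fun_mul (hγ i s)).congr_deriv ?_
      ring
  refine is_const_of_deriv_eq_zero (fun t => (h f t).differentiableAt) (fun t => ?_) s 0
  rw [(h f t).deriv, hf, map_zero]

/-- The invariant polynomials under `𝔨`. -/
def IsInv (f : Sg) : Prop := adS HA f = 0 ∧ adS H f = 0 ∧ adS E f = 0 ∧ adS F f = 0

/-- Two points that the invariant polynomials do not separate. -/
def Same (v w : Fin 8 → ℂ) : Prop :=
  ∀ f : Sg, IsInv f → MvPolynomial.eval w f = MvPolynomial.eval v f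

theorem Same.trans {u v w : Fin 8 → ℂ} (h : Same u v) (h' : Same v w) : Same u w :=
  fun f hf => (h' f hf).trans (h f hf)

theorem eval_adS_X (X : sl3) (i : Fin 8) (v : Fin 8 → ℂ) :
    MvPolynomial.eval v (adS X (MvPolynomial.X i)) = ∑ j, coord j (⁅X, bas i⁆ : sl3).1 * v j := by
  simp [adS_X, lin_apply]

/-- The hypothesis is the flow equation of ad X. Quadratic curves suffice for E and F, whose adjoint
actions have cube zero. -/
theorem eval_quadratic_curve {X : sl3} {a b c : Fin 8 → ℂ}
    (h : ∀ i s, ∑ j, coord j (⁅X, bas i⁆ : sl3).1 * (a j + b j * s + c j * s ^ 2) =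
      b i + 2 * c i * s) {f : Sg} (hf : adS X f = 0) (s : ℂ) :
    MvPolynomial.eval (fun i => a i + b i * s + c i * s ^ 2) f = MvPolynomial.eval a f := by
  have := eval_integralCurve (D := adS X) (γ := fun s i => a i + b i * s + c i * s ^ 2)
    (fun i s => ?_) hf s
  · simpa using this
  · rw [eval_adS_X, h]
    have h1 := ((hasDerivAt_id s).const_mul (b i)).const_add (a i)
    have h2 := (hasDerivAt_pow 2 s).const_mul (c i)
    refine (h1.fun_add h2).congr_deriv ?_
    simp
    ring

theorem eval_exp_curve {X : sl3} {n : Fin 8 → ℂ} (h : ∀ i, ⁅X, bas i⁆ = n i • bas i)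
    {f : Sg} (hf : adS X f = 0) (a : Fin 8 → ℂ) (s : ℂ) :
    MvPolynomial.eval (fun i => a i * Complex.exp (n i * s)) f = MvPolynomial.eval a f := by
  have := eval_integralCurve (D := adS X) (γ := fun s i => a i * Complex.exp (n i * s))
    (fun i s => ?_) hf s
  · simpa using this
  · rw [eval_adS_X, h]
    have h1 := (((hasDerivAt_id s).const_mul (n i)).cexp).const_mul (a i)
    refine h1.congr_deriv ?_
    simp [coord_bas]
    ring

/-- The second point is the first one moved for time s along the flow of ad E. -/
theorem same_E (v : Fin 8 → ℂ) (s : ℂ) :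
    Same v ![v 0, v 1 - 2 * s * v 2, v 2, v 3 + s * v 1 - s ^ 2 * v 2, v 4, v 5 + s * v 4,
      v 6 - s * v 7, v 7] := by
  obtain ⟨h1, h2, h3, h4, h5, h6, h7, h8, h9, h10, h11, h12, h13, h14, h15, h16, h17, h18, h19, h20,
    h21, h22, h23, h24, h25, h26, h27, h28⟩ := lie_table
  rw [← lie_skew, neg_eq_iff_eq_neg] at h6 h9 h13 h18 h24
  intro f hf
  rw [← eval_quadratic_curve (X := E) (a := v) (b := ![0, -2 * v 2, 0, v 1, 0, v 4, -v 7, 0])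
    (c := ![0, 0, 0, -v 2, 0, 0, 0, 0]) (fun i s => ?_) hf.2.2.1 s]
  · congr 2
    funext i
    fin_cases i <;> simp <;> ring
  · fin_cases i <;> simp [bas, *] <;> simp [Fin.sum_univ_eight, coord, H_val, E_val, E1_val, F2_val]
    all_goals ring

theorem same_F (v : Fin 8 → ℂ) (s : ℂ) :
    Same v ![v 0, v 1 + 2 * s * v 3, v 2 - s * v 1 - s ^ 2 * v 3, v 3, v 4 + s * v 5, v 5,
      v 6, v 7 - s * v 6] := by
  obtain ⟨h1, h2, h3, h4, h5, h6, h7, h8, h9, h10, h11, h12, h13, h14, h15, h16, h17, h18, h19, h20,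
    h21, h22, h23, h24, h25, h26, h27, h28⟩ := lie_table
  rw [← lie_skew, neg_eq_iff_eq_neg] at h10 h14 h19 h25
  intro f hf
  rw [← eval_quadratic_curve (X := F) (a := v) (b := ![0, 2 * v 3, -v 1, 0, v 5, 0, 0, -v 6])
    (c := ![0, 0, -v 3, 0, 0, 0, 0, 0]) (fun i s => ?_) hf.2.2.2 s]
  · congr 2
    funext i
    fin_cases i <;> simp <;> ring
  · fin_cases i <;> simp [bas, *] <;> simp [Fin.sum_univ_eight, coord, H_val, F_val, E2_val, F1_val]
    all_goals ring

theorem lie_H_bas (i : Fin 8) : ⁅H, bas i⁆ = (![0, 0, 2, -2, 1, -1, -1, 1] : Fin 8 → ℂ) i • bas i := by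
  obtain ⟨h1, h2, h3, h4, h5, h6, h7, h8, h9, h10, h11, h12, h13, h14, h15, h16, h17, h18, h19, h20,
    h21, h22, h23, h24, h25, h26, h27, h28⟩ := lie_table
  rw [← lie_skew]
  fin_cases i <;> simp [bas, *]

theorem lie_HA_bas (i : Fin 8) :
    ⁅HA, bas i⁆ = (![0, 0, 0, 0, 1, 1, -1, -1] : Fin 8 → ℂ) i • bas i := by
  obtain ⟨h1, h2, h3, h4, h5, h6, h7, h8, h9, h10, h11, h12, h13, h14, h15, h16, h17, h18, h19, h20,
    h21, h22, h23, h24, h25, h26, h27, h28⟩ := lie_table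
  rw [← lie_skew]
  fin_cases i <;> simp [bas, *]

/-- Generic points can be moved into a section. -/
theorem exists_same (v : Fin 8 → ℂ) (h4 : v 4 ≠ 0)
    (hΔ : v 4 ^ 2 * v 3 - v 4 * v 5 * v 1 - v 5 ^ 2 * v 2 ≠ 0) :
    ∃ w, Same v w ∧ w 1 = 0 ∧ w 5 = 0 ∧ w 3 = 1 ∧ w 4 = 1 := by
  obtain ⟨w, hw, w5, w4, w3⟩ : ∃ w, Same v w ∧ w 5 = 0 ∧ w 4 ≠ 0 ∧ w 3 ≠ 0 := by
    -- This time kills coordinate 5 and turns coordinate 3 into the quantity of `hΔ` divided by `v 4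
    -- ^ 2`.
    refine ⟨_, same_E v (-v 5 / v 4), ?_, ?_, ?_⟩
    · simp; field_simp; ring
    · simpa using h4
    · contrapose! hΔ
      simp at hΔ
      field_simp at hΔ
      linear_combination hΔ
  obtain ⟨w', hw', w1', w5', w4', w3'⟩ : ∃ w', Same w w' ∧ w' 1 = 0 ∧ w' 5 = 0 ∧ w' 4 ≠ 0 ∧
      w' 3 ≠ 0 := by
    -- This time kills coordinate 1; coordinate 4 survives because coordinate 5 is already zero.
    refine ⟨_, same_F w (-w 1 / (2 * w 3)), ?_, ?_, ?_, ?_⟩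
    · simp; field_simp; ring
    · simpa using w5
    · simpa [w5] using w4
    · simpa using w3
  -- The flow of H, of weight -2 on coordinate 3, normalizes that coordinate to 1. The flow of HA
  -- then normalizes coordinate 4 and does not move coordinate 3.
  have hH := fun (f : Sg) (hf : IsInv f) =>
    eval_exp_curve lie_H_bas hf.2.1 w' (Complex.log (w' 3) / 2)
  set u : Fin 8 → ℂ := fun i => w' i * Complex.exp (![0, 0, 2, -2, 1, -1, -1, 1] i *
    (Complex.log (w' 3) / 2)) with hu
  have hA := fun (f : Sg) (hf : IsInv f) =>
    eval_exp_curve lie_HA_bas hf.1 u (-Complex.log (u 4))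
  have u4 : u 4 ≠ 0 := mul_ne_zero w4' (Complex.exp_ne_zero _)
  have u3 : u 3 = 1 := by
    rw [hu]
    simp only [Matrix.cons_val]
    rw [show (-2 : ℂ) * (Complex.log (w' 3) / 2) = -Complex.log (w' 3) by ring, Complex.exp_neg,
      Complex.exp_log w3', mul_inv_cancel₀ w3']
  refine ⟨_, ((hw.trans hw').trans hH).trans hA, ?_, ?_, ?_, ?_⟩
  · simp [hu, w1']
  · simp [hu, w5']
  · simp [u3]
  · simp [Complex.exp_neg, Complex.exp_log u4, u4]

/-- The symbols of `ã, b̃, c̃, d̃`. -/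
def inv : Fin 4 → Sg :=
  let x : Fin 8 → Sg := MvPolynomial.X
  ![x 0, x 1 ^ 2 + 4 * x 2 * x 3, x 4 * x 6 + x 5 * x 7,
    2 * x 2 * x 5 * x 6 + x 1 * x 4 * x 6 - x 1 * x 5 * x 7 + 2 * x 3 * x 4 * x 7]

/-- The point of the section with given values of the invariants. -/
def sec : Fin 8 → MvPolynomial (Fin 4) ℂ :=
  ![MvPolynomial.X 0, 0, MvPolynomial.C (1 / 4) * MvPolynomial.X 1, 1, 1, 0, MvPolynomial.X 2,
    MvPolynomial.C (1 / 2) * MvPolynomial.X 3]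

/-- Every invariant polynomial is a polynomial in the four basic invariants. -/
theorem exists_eq_aeval_inv (hinv : ∀ k, IsInv (inv k)) {f : Sg} (hf : IsInv f) :
    ∃ P : MvPolynomial (Fin 4) ℂ, f = MvPolynomial.aeval inv P := by
  -- The witness is the restriction of f to the section. Normalizing coordinates 3 and 4 to 1 makes
  -- the section polynomial in the invariants, with no denominators.
  refine ⟨MvPolynomial.aeval sec f, ?_⟩
  let x : Fin 8 → Sg := MvPolynomial.X
  -- Nonvanishing of q is the genericity needed to reach the section; as S(𝔤) is a domain, the
  -- factor q can be cancelled at the end.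
  let q : Sg := x 4 * (x 4 ^ 2 * x 3 - x 4 * x 5 * x 1 - x 5 ^ 2 * x 2)
  have hq : q ≠ 0 := by
    intro h
    have := congrArg (MvPolynomial.eval ![0, 0, 0, 1, 1, 0, 0, 0]) h
    simp [q, x] at this
  have hev (v : Fin 8 → ℂ) :
      MvPolynomial.eval v (MvPolynomial.aeval inv (MvPolynomial.aeval sec f)) =
      MvPolynomial.eval (fun i => MvPolynomial.eval (fun k => MvPolynomial.eval v (inv k)) (sec i))
        f := by
    have : ((MvPolynomial.aeval v).comp ((MvPolynomial.aeval inv).comp (MvPolynomial.aeval sec)) :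
        Sg →ₐ[ℂ] ℂ) = MvPolynomial.aeval
          (fun i => MvPolynomial.eval (fun k => MvPolynomial.eval v (inv k)) (sec i)) := by
      refine MvPolynomial.algHom_ext fun i => ?_
      fin_cases i <;> simp [sec, MvPolynomial.aeval_eq_eval]
    exact DFunLike.congr_fun this f
  have key : q * (f - MvPolynomial.aeval inv (MvPolynomial.aeval sec f)) = 0 := by
    refine MvPolynomial.funext fun v => ?_
    rw [map_mul, map_zero, map_sub, hev]
    by_cases hv : v 4 ≠ 0 ∧ v 4 ^ 2 * v 3 - v 4 * v 5 * v 1 - v 5 ^ 2 * v 2 ≠ 0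
    · obtain ⟨w, hw, w1, w5, w3, w4⟩ := exists_same v hv.1 hv.2
      have hi := fun k => (hw _ (hinv k)).symm
      simp only [hi]
      rw [← hw f hf]
      have : (fun i => MvPolynomial.eval (fun k => MvPolynomial.eval w (inv k)) (sec i)) = w := by
        -- On the section the invariants are w₀, 4w₂, w₆ and 2w₇, so `sec` recovers w from them.
        funext i
        fin_cases i <;> simp [sec, inv, w1, w5, w3, w4]
      rw [this, sub_self, mul_zero]
    · have : MvPolynomial.eval v q = 0 := by
        simp only [q, x, map_mul, map_sub, map_pow, MvPolynomial.eval_X, mul_eq_zero]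
        tauto
      rw [this, zero_mul]
  exact sub_eq_zero.mp ((mul_eq_zero.mp key).resolve_left hq)

/-! ### The centralizer of `𝔨` -/

/-- The elements of `U(𝔤)` that commute with `𝔨`. -/
def CommK (u : Ug) : Prop :=
  Commute (incl HA) u ∧ Commute (incl H) u ∧ Commute (incl E) u ∧ Commute (incl F) u

/-- Applying ad X to the pair gives `(adS X p, 0)`, and the symbol of zero is zero. -/
theorem isInv_of_mem_sym {n : ℕ} {p : Sg} {u : Ug} (h : (p, u) ∈ sym n) (hu : CommK u) :
    IsInv p := by
  have key (X : sl3) (hX : Commute (incl X) u) : adS X p = 0 := by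
    have h1 := ad_mem_sym X h
    simp only [hX.eq, sub_self] at h1
    exact eq_zero_of_mem_sym h1 (zero_mem _)
  exact ⟨key _ hu.1, key _ hu.2.1, key _ hu.2.2.1, key _ hu.2.2.2⟩

theorem bas_mem_sym (i : Fin 8) : ((MvPolynomial.X i, incl (bas i)) : Sg × Ug) ∈ sym 1 := by
  rw [← lin_bas]
  exact lin_mem_sym _

theorem gen_mem_sym : (inv 0, aT) ∈ sym 1 ∧ (inv 1, bT) ∈ sym 2 ∧ (inv 2, cT) ∈ sym 2 ∧
    (inv 3, dT) ∈ sym 3 := by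
  have hH : (MvPolynomial.X 1, incl H) ∈ sym 1 := bas_mem_sym 1
  have hE : (MvPolynomial.X 2, incl E) ∈ sym 1 := bas_mem_sym 2
  have hF : (MvPolynomial.X 3, incl F) ∈ sym 1 := bas_mem_sym 3
  have hE1 : (MvPolynomial.X 4, incl E1) ∈ sym 1 := bas_mem_sym 4
  have hE2 : (MvPolynomial.X 5, incl E2) ∈ sym 1 := bas_mem_sym 5
  have hF1 : (MvPolynomial.X 6, incl F1) ∈ sym 1 := bas_mem_sym 6
  have hF2 : (MvPolynomial.X 7, incl F2) ∈ sym 1 := bas_mem_sym 7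
  refine ⟨?_, ?_, ?_, ?_⟩
  · rw [aT_eq]
    exact bas_mem_sym 0
  · convert add_mem (sym_mul hH hH)
      (Submodule.smul_mem _ (2 : ℂ) (add_mem (sym_mul hE hF) (sym_mul hF hE))) using 1
    ext1
    · simp [inv, two_smul]
      ring
    · simp only [bT, Prod.snd_add, Prod.snd_mul, two_mul, two_smul, pow_two]
  · exact add_mem (sym_mul hE1 hF1) (sym_mul hE2 hF2)
  · convert add_mem (sub_mem (add_mem
      (Submodule.smul_mem _ (2 : ℂ) (sym_mul (sym_mul hE hE2) hF1))
      (sym_mul (sym_mul hH hE1) hF1)) (sym_mul (sym_mul hH hE2) hF2))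
      (Submodule.smul_mem _ (2 : ℂ) (sym_mul (sym_mul hF hE1) hF2)) using 1
    ext1
    · simp [inv, two_smul]
      ring
    · simp only [dT, Prod.snd_add, Prod.snd_sub, Prod.snd_mul, two_mul, two_smul, add_mul]

/-- No computation in S(𝔤) is needed: these are symbols of elements commuting with 𝔨. -/
theorem isInv_inv (k : Fin 4) : IsInv (inv k) := by
  obtain ⟨h0, h1, h2, h3⟩ := gen_mem_sym
  obtain ⟨k0, k1, k2, k3⟩ := generators_mem_UgK
  fin_cases k
  · exact isInv_of_mem_sym h0 (commute_k_of_mem_UgK k0)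
  · exact isInv_of_mem_sym h1 (commute_k_of_mem_UgK k1)
  · exact isInv_of_mem_sym h2 (commute_k_of_mem_UgK k2)
  · exact isInv_of_mem_sym h3 (commute_k_of_mem_UgK k3)

theorem sym_pow {n : ℕ} {w : Sg × Ug} (hw : w ∈ sym n) (m : ℕ) : w ^ m ∈ sym (m * n) := by
  induction m with
  | zero => simpa using one_mem_sym
  | succ m ih =>
    rw [pow_succ, Nat.succ_mul]
    exact sym_mul ih hw

/-- The algebra generated by `ã, b̃, c̃, d̃`. -/
def genAlg : Subalgebra ℂ Ug := Algebra.adjoin ℂ {aT, bT, cT, dT}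

theorem genAlg_le_UgK : genAlg ≤ UgK := by
  obtain ⟨k0, k1, k2, k3⟩ := generators_mem_UgK
  refine Algebra.adjoin_le ?_
  rintro _ (rfl | rfl | rfl | rfl) <;> assumption

/-- A monomial in the invariants lifts to the same monomial in ã, b̃, c̃, d̃, of degree given by the
weights 1, 2, 2, 3. Passing to one component is needed because P itself carries no grading. -/
theorem exists_homogeneousComponent_mem_sym (P : MvPolynomial (Fin 4) ℂ) (n : ℕ) :
    ∃ u ∈ genAlg, (MvPolynomial.homogeneousComponent n (MvPolynomial.aeval inv P), u) ∈ sym n := by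
  induction P using MvPolynomial.induction_on' with
  | monomial m c =>
    obtain ⟨h0, h1, h2, h3⟩ := gen_mem_sym
    have h := Submodule.smul_mem _ c (sym_mul (sym_mul (sym_mul (sym_pow h0 (m 0))
      (sym_pow h1 (m 1))) (sym_pow h2 (m 2))) (sym_pow h3 (m 3)))
    set d := m 0 * 1 + m 1 * 2 + m 2 * 2 + m 3 * 3
    set w := c • ((inv 0, aT) ^ m 0 * (inv 1, bT) ^ m 1 * (inv 2, cT) ^ m 2 * (inv 3, dT) ^ m 3)
      with hw
    have h1 : MvPolynomial.aeval inv (MvPolynomial.monomial m c) = w.1 := by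
      rw [MvPolynomial.aeval_monomial, Finsupp.prod_fintype _ _ (by simp), Fin.prod_univ_four, hw,
        Prod.smul_fst, Algebra.smul_def]
      rfl
    have h2 : w.2 ∈ genAlg := by
      have hs (x : Ug) (hx : x ∈ ({aT, bT, cT, dT} : Set Ug)) (k : ℕ) : x ^ k ∈ genAlg :=
        pow_mem (Algebra.subset_adjoin hx) k
      rw [hw, Prod.smul_snd, Prod.snd_mul, Prod.snd_mul, Prod.snd_mul, Prod.pow_snd, Prod.pow_snd,
        Prod.pow_snd, Prod.pow_snd]
      exact genAlg.smul_mem (mul_mem (mul_mem (mul_mem (hs _ (by simp) _) (hs _ (by simp) _))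
        (hs _ (by simp) _)) (hs _ (by simp) _)) c
    rw [h1, MvPolynomial.homogeneousComponent_of_mem (isHomogeneous_of_mem_sym h)]
    split_ifs with hn
    · subst hn
      exact ⟨w.2, h2, h⟩
    · exact ⟨0, zero_mem _, zero_mem _⟩
  | add P Q hP hQ =>
    obtain ⟨u, hu, hu'⟩ := hP
    obtain ⟨v, hv, hv'⟩ := hQ
    refine ⟨u + v, add_mem hu hv, ?_⟩
    rw [map_add, map_add, ← Prod.mk_add_mk]
    exact (sym n).add_mem hu' hv'

/-- The centralizer of `𝔨` in `U(𝔤)` is generated by `ã, b̃, c̃, d̃`. -/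
theorem mem_genAlg_of_commK {u : Ug} (hu : CommK u) : u ∈ genAlg := by
  obtain ⟨n, hn⟩ := exists_mem_fil u
  induction n generalizing u with
  | zero =>
    -- The filtration uses strict length, so `fil 0` excludes even the scalars.
    have : fil 0 = ⊥ := by simp [fil]
    rw [this, Submodule.mem_bot] at hn
    rw [hn]
    exact zero_mem _
  | succ n ih =>
    obtain ⟨p, hp⟩ := exists_mem_sym hn
    obtain ⟨P, hP⟩ := exists_eq_aeval_inv isInv_inv (isInv_of_mem_sym hp hu)
    obtain ⟨v, hv, hv'⟩ := exists_homogeneousComponent_mem_sym P n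
    rw [← hP, MvPolynomial.homogeneousComponent_of_mem (isHomogeneous_of_mem_sym hp), if_pos rfl]
      at hv'
    have h1 := sub_mem hp hv'
    rw [Prod.mk_sub_mk, sub_self] at h1
    obtain ⟨v0, v1, v2, v3⟩ := commute_k_of_mem_UgK (genAlg_le_UgK hv)
    have h2 : u - v ∈ genAlg := ih ⟨hu.1.sub_right v0, hu.2.1.sub_right v1, hu.2.2.1.sub_right v2,
      hu.2.2.2.sub_right v3⟩ (mem_fil_of_zero_mem_sym h1)
    simpa using add_mem h2 hv

theorem UgK_eq_genAlg : UgK = genAlg :=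
  le_antisymm (fun _ hu => mem_genAlg_of_commK (commute_k_of_mem_UgK hu)) genAlg_le_UgK

/-! ### The centers -/

theorem mem_center_of_commute {L : Type*} [LieRing L] [LieAlgebra ℂ L]
    {u : UniversalEnvelopingAlgebra ℂ L}
    (h : ∀ X, Commute (UniversalEnvelopingAlgebra.ι ℂ X) u) :
    u ∈ Subalgebra.center ℂ (UniversalEnvelopingAlgebra ℂ L) := by
  rw [Subalgebra.mem_center_iff]
  intro v
  have hv : v ∈ Algebra.adjoin ℂ (Set.range (UniversalEnvelopingAlgebra.ι ℂ : L → _)) := by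
    rw [adjoin_range_ι_eq_top]; trivial
  have hle : Algebra.adjoin ℂ (Set.range (UniversalEnvelopingAlgebra.ι ℂ : L → _)) ≤
      Subalgebra.centralizer ℂ {u} := by
    refine Algebra.adjoin_le ?_
    rintro _ ⟨X, rfl⟩
    rw [SetLike.mem_coe, Subalgebra.mem_centralizer_iff]
    rintro _ rfl
    exact (h X).eq.symm
  exact ((Subalgebra.mem_centralizer_iff ℂ).mp (hle hv) u rfl).symm

theorem mem_Zg_of_commute {u : Ug} (h : ∀ i, Commute (incl (bas i)) u) : u ∈ Zg := by
  refine mem_center_of_commute fun X => ?_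
  change Commute (incl X) u
  rw [incl_eq_sum]
  exact Commute.sum_left _ _ _ fun i _ => (h i).smul_left _

/-- The commutant of u is closed under brackets, and E₁, F₁ arise from E₂, F₂ by bracketing with E
and F. -/
theorem mem_Zg_of_commK {u : Ug} (hk : CommK u) (h2 : Commute (incl E2) u)
    (h2' : Commute (incl F2) u) : u ∈ Zg := by
  obtain ⟨t1, t2, t3, t4, t5, t6, t7, t8, t9, t10, t11, t12, t13, t14, t15, t16, t17, t18, t19, t20,
    t21, t22, t23, t24, t25, t26, t27, t28⟩ := lie_table
  have hlie {X Y : sl3} (hX : Commute (incl X) u) (hY : Commute (incl Y) u) :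
      Commute (incl ⁅X, Y⁆) u := by
    rw [LieHom.map_lie, LieRing.of_associative_ring_bracket]
    exact (hX.mul_left hY).sub_left (hY.mul_left hX)
  have h1 : Commute (incl E1) u := by
    have := hlie h2 hk.2.2.1
    rw [t13, map_neg] at this
    exact Commute.neg_left_iff.mp this
  have h1' : Commute (incl F1) u := by
    have := hlie h2' hk.2.2.2
    rwa [t25] at this
  obtain ⟨k0, k1, k2, k3⟩ := hk
  refine mem_Zg_of_commute fun i => ?_
  fin_cases i <;> simpa only [bas] using by assumption

theorem Cas_mem_UgK : Cas ∈ UgK := by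
  obtain ⟨k0, k1, k2, -⟩ := generators_mem_UgK
  rw [Cas_eq]
  exact sub_mem (add_mem (add_mem (UgK.smul_mem (pow_mem k0 2) _) (UgK.smul_mem k1 _))
    (UgK.smul_mem k2 _)) (UgK.smul_mem k0 _)

theorem cub_mem_UgK : cub ∈ UgK := by
  obtain ⟨k0, k1, k2, k3⟩ := generators_mem_UgK
  exact sub_mem (add_mem (sub_mem (add_mem (sub_mem (add_mem (neg_mem
    (UgK.smul_mem (pow_mem k0 3) _)) (UgK.smul_mem (mul_mem k0 k1) _))
    (UgK.smul_mem (mul_mem k0 k2) _)) (UgK.smul_mem (pow_mem k0 2) _)) (UgK.smul_mem k0 _))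
    (UgK.smul_mem k3 _)) (UgK.smul_mem k1 _)

theorem Cas_mem_Zg : Cas ∈ Zg :=
  mem_Zg_of_commK (commute_k_of_mem_UgK Cas_mem_UgK) commute_of_table.1 commute_of_table.2.1

theorem cub_mem_Zg : cub ∈ Zg :=
  mem_Zg_of_commK (commute_k_of_mem_UgK cub_mem_UgK) commute_of_table.2.2.1 commute_of_table.2.2.2

theorem bas_mem_k : H ∈ k ∧ HA ∈ k ∧ E ∈ k ∧ F ∈ k := by
  refine ⟨?_, ?_, ?_, ?_⟩ <;> change IsBlockDiag _ <;>
    simp [IsBlockDiag, H_val, HA_val, E_val, F_val]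

theorem inclUk_ι (X : k) :
    inclUk (UniversalEnvelopingAlgebra.ι ℂ X) = incl (X : sl3) :=
  UniversalEnvelopingAlgebra.lift_ι_apply ℂ (incl.comp k.incl) X

/-- `H² + 2 (E F + F E)` commutes with an `𝔰𝔩₂`-triple `H, E, F`. -/
theorem commute_casimir_sl2 {A : Type*} [Ring A] {h e f : A} (he : e * h = h * e - 2 * e)
    (hf : f * h = h * f + 2 * f) (hef : f * e = e * f - h) :
    Commute h (h ^ 2 + 2 * (e * f + f * e)) ∧ Commute e (h ^ 2 + 2 * (e * f + f * e)) ∧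
      Commute f (h ^ 2 + 2 * (e * f + f * e)) := by
  have he' (u : A) : e * (h * u) = h * (e * u) - 2 * (e * u) := by
    rw [← mul_assoc, he]; noncomm_ring
  have hf' (u : A) : f * (h * u) = h * (f * u) + 2 * (f * u) := by
    rw [← mul_assoc, hf]; noncomm_ring
  have hef' (u : A) : f * (e * u) = e * (f * u) - h * u := by
    rw [← mul_assoc, hef]; noncomm_ring
  refine ⟨?_, ?_, ?_⟩ <;> rw [commute_iff_eq] <;>
    simp only [pow_two, two_mul, mul_add, add_mul, mul_sub, sub_mul, mul_assoc, he, hf, hef, he',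
      hf', hef'] <;> abel

theorem mem_center_k_of_commute {u : UniversalEnvelopingAlgebra ℂ k}
    (hA : Commute (UniversalEnvelopingAlgebra.ι ℂ (⟨HA, bas_mem_k.2.1⟩ : k)) u)
    (hH : Commute (UniversalEnvelopingAlgebra.ι ℂ (⟨H, bas_mem_k.1⟩ : k)) u)
    (hE : Commute (UniversalEnvelopingAlgebra.ι ℂ (⟨E, bas_mem_k.2.2.1⟩ : k)) u)
    (hF : Commute (UniversalEnvelopingAlgebra.ι ℂ (⟨F, bas_mem_k.2.2.2⟩ : k)) u) :
    u ∈ Subalgebra.center ℂ (UniversalEnvelopingAlgebra ℂ k) := by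
  refine mem_center_of_commute fun X => ?_
  have hX : X = coord 0 X.1.1 • (⟨HA, bas_mem_k.2.1⟩ : k) + coord 1 X.1.1 • (⟨H, bas_mem_k.1⟩ : k)
      + coord 2 X.1.1 • (⟨E, bas_mem_k.2.2.1⟩ : k) + coord 3 X.1.1 • (⟨F, bas_mem_k.2.2.2⟩ : k) :=
    Subtype.ext (eq_of_mem_k X.1 X.2)
  rw [hX]
  simp only [map_add, map_smul]
  exact (((hA.smul_left _).add_left (hH.smul_left _)).add_left (hE.smul_left _)).add_left
    (hF.smul_left _)

theorem aT_bT_mem_Zk : aT ∈ Zk ∧ bT ∈ Zk := by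
  obtain ⟨t1, t2, t3, t4, t5, t6, -⟩ := lie_table
  let ik := UniversalEnvelopingAlgebra.ι ℂ (L := k)
  have hmul (X Y : k) : ik X * ik Y = ik Y * ik X + ik ⁅X, Y⁆ := by
    rw [LieHom.map_lie, LieRing.of_associative_ring_bracket]
    abel
  let a : k := ⟨HA, bas_mem_k.2.1⟩
  let h : k := ⟨H, bas_mem_k.1⟩
  let e : k := ⟨E, bas_mem_k.2.2.1⟩
  let f : k := ⟨F, bas_mem_k.2.2.2⟩
  have ha : ⁅h, a⁆ = 0 := Subtype.ext t1
  have ea : ⁅e, a⁆ = 0 := Subtype.ext t2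
  have eh : ⁅e, h⁆ = (-2 : ℂ) • e := Subtype.ext t3
  have fa : ⁅f, a⁆ = 0 := Subtype.ext t4
  have fh : ⁅f, h⁆ = (2 : ℂ) • f := Subtype.ext t5
  have fe : ⁅f, e⁆ = -h := Subtype.ext t6
  have cha : Commute (ik h) (ik a) := by have := hmul h a; rwa [ha, map_zero, add_zero] at this
  have cea : Commute (ik e) (ik a) := by have := hmul e a; rwa [ea, map_zero, add_zero] at this
  have cfa : Commute (ik f) (ik a) := by have := hmul f a; rwa [fa, map_zero, add_zero] at this
  have heh : ik e * ik h = ik h * ik e - 2 * ik e := by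
    rw [hmul, eh, map_smul, two_mul]; module
  have hfh : ik f * ik h = ik h * ik f + 2 * ik f := by
    rw [hmul, fh, map_smul, two_mul]; module
  have hfe : ik f * ik e = ik e * ik f - ik h := by
    rw [hmul, fe, map_neg]; abel
  obtain ⟨c1, c2, c3⟩ := commute_casimir_sl2 heh hfh hfe
  have c4 : Commute (ik a) (ik h ^ 2 + 2 * (ik e * ik f + ik f * ik e)) := by
    rw [two_mul]
    have c5 := (cea.symm.mul_right cfa.symm).add_right (cfa.symm.mul_right cea.symm)
    exact (cha.symm.pow_right 2).add_right (c5.add_right c5)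
  refine ⟨⟨ik a, mem_center_k_of_commute (Commute.refl _) cha cea cfa, ?_⟩,
    ⟨_, mem_center_k_of_commute c4 c1 c2 c3, ?_⟩⟩
  · rw [aT_eq]
    exact inclUk_ι a
  · change inclUk _ = _
    simp only [map_add, map_mul, map_pow, map_ofNat]
    simp only [ik, inclUk_ι]
    rfl

theorem commK_of_mem_Zk {w : Ug} (hw : w ∈ Zk) : CommK w := by
  obtain ⟨v, hv, rfl⟩ := hw
  have hv' := Subalgebra.mem_center_iff.mp hv
  have key (X : sl3) (hX : X ∈ k) : Commute (incl X) (inclUk v) := by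
    have := congrArg inclUk (hv' (UniversalEnvelopingAlgebra.ι ℂ (⟨X, hX⟩ : k)))
    rw [map_mul, map_mul, inclUk_ι] at this
    exact this
  exact ⟨key _ bas_mem_k.2.1, key _ bas_mem_k.1, key _ bas_mem_k.2.2.1, key _ bas_mem_k.2.2.2⟩

theorem commK_of_mem_Zg {z : Ug} (hz : z ∈ Zg) : CommK z :=
  have h := Subalgebra.mem_center_iff.mp hz
  ⟨h _, h _, h _, h _⟩

/-- As Z(𝔤) is central, the product of the two centers is closed under multiplication, so one
inclusion need only be checked on generators. The other holds because the products commute with 𝔨.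
-/
theorem UgK_eq_Zg_mul_Zk :
    Subalgebra.toSubmodule UgK = Subalgebra.toSubmodule Zg * Subalgebra.toSubmodule Zk := by
  apply le_antisymm
  · have hg {z : Ug} (hz : z ∈ Zg) : z ∈ Subalgebra.toSubmodule Zg * Subalgebra.toSubmodule Zk := by
      rw [← mul_one z]
      exact Submodule.mul_mem_mul hz (one_mem Zk)
    have hk {z : Ug} (hz : z ∈ Zk) : z ∈ Subalgebra.toSubmodule Zg * Subalgebra.toSubmodule Zk := by
      rw [← one_mul z]
      exact Submodule.mul_mem_mul (one_mem Zg) hz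
    have hcomm : Subalgebra.toSubmodule Zk * Subalgebra.toSubmodule Zg ≤
        Subalgebra.toSubmodule Zg * Subalgebra.toSubmodule Zk := by
      rw [Submodule.mul_le]
      intro w hw z hz
      rw [Subalgebra.mem_center_iff.mp (show z ∈ Subalgebra.center ℂ Ug from hz) w]
      exact Submodule.mul_mem_mul hz hw
    have hmul : (Subalgebra.toSubmodule Zg * Subalgebra.toSubmodule Zk) *
        (Subalgebra.toSubmodule Zg * Subalgebra.toSubmodule Zk) ≤
        Subalgebra.toSubmodule Zg * Subalgebra.toSubmodule Zk := by
      calc _ = Subalgebra.toSubmodule Zg *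
            (Subalgebra.toSubmodule Zk * Subalgebra.toSubmodule Zg) * Subalgebra.toSubmodule Zk := by
            simp only [mul_assoc]
        _ ≤ Subalgebra.toSubmodule Zg *
            (Subalgebra.toSubmodule Zg * Subalgebra.toSubmodule Zk) * Subalgebra.toSubmodule Zk :=
            mul_le_mul' (mul_le_mul' le_rfl hcomm) le_rfl
        _ = (Subalgebra.toSubmodule Zg * Subalgebra.toSubmodule Zg) *
            (Subalgebra.toSubmodule Zk * Subalgebra.toSubmodule Zk) := by simp only [mul_assoc]
        _ = _ := by rw [(Subalgebra.isIdempotentElem_toSubmodule Zg).eq,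
            (Subalgebra.isIdempotentElem_toSubmodule Zk).eq]
    obtain ⟨ha, hb⟩ := aT_bT_mem_Zk
    have hs {x : Ug} (c : ℂ) (hx : x ∈ Subalgebra.toSubmodule Zg * Subalgebra.toSubmodule Zk) :=
      Submodule.smul_mem _ c hx
    intro u hu
    rw [UgK_eq_genAlg] at hu
    induction hu using Algebra.adjoin_induction with
    | mem x hx =>
      obtain rfl | rfl | rfl | rfl := hx
      · exact hk ha
      · exact hk hb
      · rw [cT_eq]
        exact add_mem (sub_mem (sub_mem (hs _ (hg Cas_mem_Zg)) (hs _ (hk (pow_mem ha 2))))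
          (hs _ (hk hb))) (hs _ (hk ha))
      · rw [dT_eq, Subalgebra.mem_center_iff.mp Cas_mem_Zg aT]
        exact add_mem (add_mem (sub_mem (sub_mem (add_mem (hs _ (hg cub_mem_Zg))
          (hs _ (Submodule.mul_mem_mul Cas_mem_Zg ha))) (hs _ (hk (pow_mem ha 3))))
          (hs _ (hk (mul_mem ha hb)))) (hk ha)) (hs _ (hk hb))
    | algebraMap r => exact hg (Zg.algebraMap_mem r)
    | add x y _ _ hx hy => exact add_mem hx hy
    | mul x y _ _ hx hy => exact hmul (Submodule.mul_mem_mul hx hy)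
  · rw [Submodule.mul_le]
    intro z hz w hw
    obtain ⟨z0, z1, z2, z3⟩ := commK_of_mem_Zg hz
    obtain ⟨w0, w1, w2, w3⟩ := commK_of_mem_Zk hw
    exact genAlg_le_UgK (mem_genAlg_of_commK
      ⟨z0.mul_right w0, z1.mul_right w1, z2.mul_right w2, z3.mul_right w3⟩)

/-! ### The Casimir element -/

/-- The basis dual to `bas` with respect to the trace form. -/
def dual : Fin 8 → sl3 :=
  ![(3 / 2 : ℂ) • HA, (1 / 2 : ℂ) • H, F, E, F1, F2, E1, E2]

theorem trace_mul_dual (X : sl3) (j : Fin 8) :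
    Matrix.trace (X.1 * (dual j).1) = coord j X.1 := by
  have ht := trace_eq X
  fin_cases j <;>
    simp [dual, coord, Matrix.trace_fin_three, HA_val, H_val, E_val, F_val, E1_val, E2_val, F1_val,
      F2_val, Matrix.mul_apply, Fin.sum_univ_three] <;>
    first | ring1 | linear_combination (1 / 2) * ht

theorem Cas_eq_sum_dual : Cas = ∑ j, incl (bas j) * incl (dual j) := by
  have h1 : H1 + H2 = HA := rfl
  have h2 : H1 - H2 = H := rfl
  rw [Cas, ← map_add, ← map_sub, h1, h2]
  simp [Fin.sum_univ_eight, bas, dual, -UniversalEnvelopingAlgebra.ι_apply, pow_two]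
  module

theorem Cas_eq_sum (e : Module.Basis (Fin 8) ℂ sl3) (e' : Fin 8 → sl3)
    (h : ∀ i j, Matrix.trace ((e i).1 * (e' j).1) = if i = j then 1 else 0) :
    Cas = ∑ i, incl (e i) * incl (e' i) := by
  -- The difference of the two sides is trace-orthogonal to every `e i`, hence to 𝔤. It vanishes
  -- since its coordinates are traces against `dual`.
  have hy (y : sl3) : y = ∑ i, Matrix.trace ((e i).1 * y.1) • e' i := by
    let z := y - ∑ i, Matrix.trace ((e i).1 * y.1) • e' i
    let τ : sl3 →ₗ[ℂ] ℂ := (Matrix.traceLinearMap (Fin 3) ℂ ℂ).comp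
      ((LinearMap.mulRight ℂ z.1).comp sl3.toSubmodule.subtype)
    have hτ : τ = 0 := by
      refine e.ext fun k => ?_
      change Matrix.trace ((e k).1 * (y - ∑ i, Matrix.trace ((e i).1 * y.1) • e' i).1) = 0
      have hc : (y - ∑ i, Matrix.trace ((e i).1 * y.1) • e' i).1 =
          y.1 - ∑ i, Matrix.trace ((e i).1 * y.1) • (e' i).1 := by
        simp
      rw [hc, mul_sub, Finset.mul_sum, Matrix.trace_sub, Matrix.trace_sum]
      simp [h]
    have hz : z = 0 := by
      refine ext_coord fun j => ?_
      rw [← trace_mul_dual, Matrix.trace_mul_comm]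
      have : τ (dual j) = 0 := by rw [hτ]; rfl
      exact this.trans (map_zero (coord j)).symm
    exact sub_eq_zero.mp hz
  rw [Cas_eq_sum_dual]
  calc ∑ j, incl (bas j) * incl (dual j)
      = ∑ j, ∑ i, coord j (e i).1 • (incl (bas j) * incl (e' i)) := by
        refine Finset.sum_congr rfl fun j _ => ?_
        conv_lhs => rw [hy (dual j)]
        simp only [map_sum, map_smul, Finset.mul_sum, mul_smul_comm, trace_mul_dual]
    _ = ∑ i, ∑ j, coord j (e i).1 • (incl (bas j) * incl (e' i)) := Finset.sum_comm
    _ = ∑ i, incl (e i) * incl (e' i) := by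
        refine Finset.sum_congr rfl fun i _ => ?_
        rw [incl_eq_sum (e i), Finset.sum_mul]
        simp only [smul_mul_assoc]

end SU21

end

theorem mainTheorem5 :
    -- `U(𝔤)^K = Z(𝔤) Z(𝔨)`, the linear span of the products `z w`, `z ∈ Z(𝔤)`, `w ∈ Z(𝔨)`
    Subalgebra.toSubmodule SU21.UgK =
        Subalgebra.toSubmodule SU21.Zg * Subalgebra.toSubmodule SU21.Zk ∧
    -- `U(𝔤)^K` is generated by `ã, b̃, c̃, d̃`
    SU21.UgK = Algebra.adjoin ℂ {SU21.aT, SU21.bT, SU21.cT, SU21.dT} ∧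
    -- `ã` and `b̃` lie in `Z(𝔨)`
    SU21.aT ∈ SU21.Zk ∧ SU21.bT ∈ SU21.Zk ∧
    -- `Ω` is the Casimir element: it is `∑ eᵢ eⁱ` for any dual bases for the trace form
    (∀ (e : Module.Basis (Fin 8) ℂ SU21.sl3) (e' : Fin 8 → SU21.sl3),
      (∀ i j, Matrix.trace ((e i).1 * (e' j).1) = if i = j then 1 else 0) →
        SU21.Cas = ∑ i, SU21.incl (e i) * SU21.incl (e' i)) ∧
    -- `Ω` and `cub` are central in `U(𝔤)`
    SU21.Cas ∈ SU21.Zg ∧ SU21.cub ∈ SU21.Zg ∧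
    -- `Ω = (3/2) ã² + (1/2) b̃ + 2 c̃ - 3 ã`
    SU21.Cas = (3 / 2 : ℂ) • SU21.aT ^ 2 + (1 / 2 : ℂ) • SU21.bT + (2 : ℂ) • SU21.cT
      - (3 : ℂ) • SU21.aT ∧
    -- `c̃` and `d̃` through `Ω`, `cub`, `ã`, `b̃`
    SU21.cT = (1 / 2 : ℂ) • SU21.Cas - (3 / 4 : ℂ) • SU21.aT ^ 2 - (1 / 4 : ℂ) • SU21.bT
      + (3 / 2 : ℂ) • SU21.aT ∧
    SU21.dT = (1 / 3 : ℂ) • SU21.cub + (1 / 2 : ℂ) • (SU21.aT * SU21.Cas)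
      - (1 / 4 : ℂ) • SU21.aT ^ 3 - (3 / 4 : ℂ) • (SU21.aT * SU21.bT) + SU21.aT
      + (1 / 2 : ℂ) • SU21.bT := by
  exact ⟨SU21.UgK_eq_Zg_mul_Zk, SU21.UgK_eq_genAlg, SU21.aT_bT_mem_Zk.1, SU21.aT_bT_mem_Zk.2,
    SU21.Cas_eq_sum, SU21.Cas_mem_Zg, SU21.cub_mem_Zg, SU21.Cas_eq, SU21.cT_eq, SU21.dT_eq⟩
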